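/- Let $d\ge 2$, let $\mu=(\mu_1,\dots,\mu_\ell)$ be an ordered partition of $d$ with positive parts, and put $b=\ell+d-2\ge 1$. **Paths.** A Dyck path of length $2n$ consists of up-steps $u=(1,1)$ and down-steps $d=(1,-1)$, starts at $(0,0)$, ends at $(2n,0)$ and stays weakly above the $x$-axis. It is *primitive* if exactly one of its down-steps starts at height $1$, and it is a *$b$-Dyck path* if every maximal run of up-steps has length divisible by $b$. A lattice point of a $b$-Dyck path is *distinguished* if it is followed by an up-step and the number of up-steps before it is a multiple of $b$. A *single Hurwitz Dyck path of type $\mu$* is a primitive $b$-Dyck path $D$ of length $2bd$ whose distinguished vertices are labelled $1,\dots,d$, together with $\ell$ labelled marked pairs $(v,w)$ of lattice points of equal height, $v$ to the left of $w$, all marked points other than the origin being end points of down-steps, such that: 1. $((0,0),(2bd,0))$ is one of the marked pairs; 2. the heights of the marked pairs have $\ell$ distinct residues modulo $b+1$; 3. the heights of the distinguished vertices have $d$ distinct residues modulo $b+1$; 4. the residues modulo $b+1$ of the nonzero heights of marked pairs are disjoint from those of the nonzero heights of distinguished vertices; 5. the marked pairs do not cross: no two pairs $(v_1,w_1),(v_2,w_2)$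 have $x$-coordinates $v_1<v_2<w_1<w_2$; 6. the pair labelled $i$ has degree $\mu_i$: the part of $D$ between its two points, with the parts between the points of all other marked pairs nested in it removed (its *essential interval*), contains $b\mu_i$ up-steps. **Galaxies.** A *Hurwitz galaxy of type $(0,\mu,(1^d))$* is a connected graph on the oriented sphere with disc faces coloured black and white such that each edge separates a white from a black face. There are $\ell$ labelled white faces, the $i$-th of perimeter $(b+1)\mu_i$, and $d$ labelled black faces of perimeter $b+1$. The vertices are coloured $0,\dots,b$ cyclically, clockwise around white faces; there are $d$ vertices of colour $0$, all $2$-valent, and for each colour $1,\dots,b$ there are $d-1$ vertices, one of them $4$-valent and the others $2$-valent. It is *pruned* if no black face is a bubble, that is, has exactly one $4$-valent vertex on its boundary. **From paths to galaxies.** A single Hurwitz Dyck path $D$ gives a surface as follows. For each distinguished vertex $x$, the $b$ up-steps starting at $x$ together with one new internal edge from their end back to $x$ bound a black polygon. For each marked pair, the down-steps in its essential interval and the internal edges of the black polygons starting in it bound a white polygon, around which they occur counterclockwise in the order in which the path meets them. The two points of each marked pair are identified, and each up-step is glued to its matching down-step, i.e. the nearest down-step to the right with equally many up- and down-steps in between.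 A vertex is coloured by its height modulo $b+1$; the faces carry the labels of the distinguished vertices and of the marked pairs. Call the result $G(D)$. **Proposition.** For every single Hurwitz Dyck path $D$ of type $\mu$, $G(D)$ is a Hurwitz galaxy of type $(0,\mu,(1^d))$, and it is pruned if and only if both of the following conditions hold. * (Descent condition) Every sequence of $b$ consecutive down-steps of $D$ that begins at a peak contains a vertex belonging to a marked pair (the two ends of the sequence included). * (Lowest distinguished vertex condition) The distinguished vertex $v$ of lowest nonzero height is not the second distinguished vertex of $D$ from the left (that is, the origin is not the only distinguished vertex to the left of $v$), or else some vertex belonging to a marked pair other than $((0,0),(2bd,0))$ lies to the left of $v$. -/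

import Mathlib

namespace Hurwitz

/-! ## Galaxies

A graph cellularly embedded in a compact oriented surface, with faces coloured black and white so that
every edge has a white face on one side and a black face on the other, is encoded up to
orientation-preserving homeomorphism by its rotation data. Every edge is oriented so that the white
face is on its right and the black face on its left (so white faces are traversed clockwise and black
faces counterclockwise). -/

/-- Rotation data of an embedded graph with bicoloured faces, together with vertex colours
in `{0, …, b}` and labels of the `m` white and `n` black faces. -/
structure FaceColouredMap (b m n : ℕ) where
  /-- the oriented edges -/
  Edge : Type
  /-- the edge that follows `e` on the boundary of the white face on the right of `e` -/
  white : Edge → Edge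
  /-- the edge that follows `e` on the boundary of the black face on the left of `e` -/
  black : Edge → Edge
  /-- the colour of the head (end point) of an edge -/
  colour : Edge → ZMod (b + 1)
  /-- the label of the white face on the right of an edge -/
  whiteLabel : Edge → Fin m
  /-- the label of the black face on the left of an edge -/
  blackLabel : Edge → Fin n

namespace FaceColouredMap

variable {b m n : ℕ} (G : FaceColouredMap b m n)

/-- A vertex, as the class of the edges that end in it: the heads of `e` and `e'` coincide when some edge
follows `e` along a black face and `e'` along a white face (`e` and `e'` are then consecutive incoming
edges around the vertex). -/
def Vertex : Type := Quot fun e e' : G.Edge => G.black e = G.white e'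

def WhiteFace : Type := Quot fun e e' : G.Edge => G.white e = e'

def BlackFace : Type := Quot fun e e' : G.Edge => G.black e = e'

/-- The vertex in which an edge ends. -/
def head (e : G.Edge) : G.Vertex := Quot.mk _ e

/-- The white face on the right of an edge. -/
def whiteFace (e : G.Edge) : G.WhiteFace := Quot.mk _ e

/-- The black face on the left of an edge. -/
def blackFace (e : G.Edge) : G.BlackFace := Quot.mk _ e

/-- The number of half-edges at a vertex: incoming and outgoing edges alternate around it. -/
noncomputable def valency (v : G.Vertex) : ℕ := 2 * {e | G.head e = v}.ncard

/-- The vertices of colour `c`. -/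
def colourClass (c : ZMod (b + 1)) : Set G.Vertex := {v | ∃ e, G.head e = v ∧ G.colour e = c}

end FaceColouredMap

/-- `G` is a Hurwitz galaxy of type `(g, μ, ν)`, where `b = 2g - 2 + ℓ(μ) + ℓ(ν)`. -/
structure IsHurwitzGalaxy {d b : ℕ} (g : ℕ) (μ ν : Composition d)
    (G : FaceColouredMap b μ.length ν.length) : Prop where
  b_eq : b + 2 = 2 * g + μ.length + ν.length
  finite : Finite G.Edge
  nonempty : Nonempty G.Edge
  white_bijective : Function.Bijective G.white
  black_bijective : Function.Bijective G.black
  connected : ∀ e e', Relation.EqvGen (fun a c => G.white a = c ∨ G.black a = c) e e'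
  /-- The surface has genus `g`. -/
  euler : Nat.card G.Vertex + Nat.card G.WhiteFace + Nat.card G.BlackFace + 2 * g
    = Nat.card G.Edge + 2
  /-- The labels are labels of the faces. -/
  whiteLabel_iff : ∀ e e', G.whiteLabel e = G.whiteLabel e' ↔ G.whiteFace e = G.whiteFace e'
  blackLabel_iff : ∀ e e', G.blackLabel e = G.blackLabel e' ↔ G.blackFace e = G.blackFace e'
  /-- The white face labelled `i` has perimeter `μ_i (b + 1)`. -/
  white_perimeter : ∀ i, {e | G.whiteLabel e = i}.ncard = μ.blocksFun i * (b + 1)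
  /-- The black face labelled `i` has perimeter `ν_i (b + 1)`. -/
  black_perimeter : ∀ i, {e | G.blackLabel e = i}.ncard = ν.blocksFun i * (b + 1)
  /-- The colours `0, …, b` follow each other cyclically along every face. -/
  colour_white : ∀ e, G.colour (G.white e) = G.colour e + 1
  colour_black : ∀ e, G.colour (G.black e) = G.colour e + 1
  /-- For `c ≠ 0` there are `d - 1` vertices of colour `c`: one is 4-valent, the others 2-valent. -/
  colour_ne_zero : ∀ c, c ≠ 0 → (G.colourClass c).ncard = d - 1 ∧
    {v | v ∈ G.colourClass c ∧ G.valency v = 2}.ncard = d - 2 ∧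
    {v | v ∈ G.colourClass c ∧ G.valency v = 4}.ncard = 1
  /-- There are `d` vertices of colour `0`, all of them 2-valent. -/
  colour_zero : (G.colourClass 0).ncard = d ∧ ∀ v ∈ G.colourClass 0, G.valency v = 2

/-- A black face is a bubble if there is exactly one 4-valent vertex on its boundary. -/
def IsBlackBubble {b m n : ℕ} (G : FaceColouredMap b m n) (F : G.BlackFace) : Prop :=
  {v | G.valency v = 4 ∧ ∃ e, G.blackFace e = F ∧ G.head e = v}.ncard = 1

/-- Pruned Hurwitz galaxies of type `(g, μ, 1^d)`: no black face is a bubble. -/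
def IsPrunedHurwitzGalaxy {d b : ℕ} (g : ℕ) (μ : Composition d)
    (G : FaceColouredMap b μ.length (Composition.ones d).length) : Prop :=
  IsHurwitzGalaxy g μ (Composition.ones d) G ∧ ∀ F, ¬ IsBlackBubble G F

/-! ## Dyck paths

A Dyck path is a `DyckWord`. Its lattice points are named by their `x`-coordinates
`0, …, length`, and the step from `x` to `x + 1` is named by `x`. -/

/-- The step that starts at `x` is an up-step. -/
def IsUp (w : DyckWord) (x : ℕ) : Prop := w.toList[x]? = some DyckStep.U

/-- The step that starts at `x` is a down-step. -/
def IsDown (w : DyckWord) (x : ℕ) : Prop := w.toList[x]? = some DyckStep.D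

/-- The number of up-steps before the lattice point `x`. -/
def upsBefore (w : DyckWord) (x : ℕ) : ℕ := (w.toList.take x).count DyckStep.U

/-- The `y`-coordinate of the lattice point `x` (the subtraction is never truncated, as the path stays
weakly above the axis). -/
def height (w : DyckWord) (x : ℕ) : ℕ := upsBefore w x - (w.toList.take x).count DyckStep.D

/-- There is exactly one return step, that is, one down-step that starts at height `1`. -/
def IsPrimitive (w : DyckWord) : Prop := ∃! x, IsDown w x ∧ height w x = 1

/-- The lattice point `x` is an end point of a down-step. -/
def IsDownVertex (w : DyckWord) (x : ℕ) : Prop := IsDown w x ∨ ∃ y, x = y + 1 ∧ IsDown w y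

/-- `b`-Dyck paths: every maximal run of up-steps has length divisible by `b`. -/
def IsBDyck (b : ℕ) (w : DyckWord) : Prop :=
  0 < b ∧ b ∣ w.semilength ∧
    ∀ x y, x < y → (∀ z, x ≤ z → z < y → IsUp w z) → ¬ IsUp w y →
      (∀ z, x = z + 1 → ¬ IsUp w z) → b ∣ y - x

/-- Distinguished vertices of a `b`-Dyck path. -/
def IsDistinguished (b : ℕ) (w : DyckWord) (x : ℕ) : Prop := b ∣ upsBefore w x ∧ IsUp w x

/-- The position of the matching down-step of the up-step at `x`: the nearest down-step to the right with
as many up-steps as down-steps between them (equivalently, starting at the height at which the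
up-step ends). -/
noncomputable def matchingDown (w : DyckWord) (x : ℕ) : ℕ :=
  sInf {y | x < y ∧ IsDown w y ∧ height w y = height w (x + 1)}

/-- A Dyck path with `t` labelled marked pairs `(left i, right i)` of vertices of equal height. All marked
vertices other than the origin are vertices of down-steps. -/
structure MarkedDyckPath (t : ℕ) where
  path : DyckWord
  left : Fin t → ℕ
  right : Fin t → ℕ
  left_lt_right : ∀ i, left i < right i
  right_le : ∀ i, right i ≤ path.toList.length
  height_eq : ∀ i, height path (left i) = height path (right i)
  left_down : ∀ i, left i ≠ 0 → IsDownVertex path (left i)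
  right_down : ∀ i, IsDownVertex path (right i)

namespace MarkedDyckPath

variable {t : ℕ} (D : MarkedDyckPath t)

/-- The step at `s` belongs to the essential interval of the `i`-th marked pair. -/
def InEssential (i : Fin t) (s : ℕ) : Prop :=
  (D.left i ≤ s ∧ s < D.right i) ∧
    ∀ j, j ≠ i → D.left i ≤ D.left j → D.right j ≤ D.right i → ¬ (D.left j ≤ s ∧ s < D.right j)

/-- The degree of a marked pair in a `b`-Dyck path. -/
noncomputable def degree (b : ℕ) (i : Fin t) : ℚ :=
  ({s | D.InEssential i s ∧ IsUp D.path s}.ncard : ℚ) / b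

/-- The lattice point `x` belongs to the `i`-th marked pair. -/
def Marks (i : Fin t) (x : ℕ) : Prop := x = D.left i ∨ x = D.right i

end MarkedDyckPath

/-- The number `b = ℓ(μ) + d - 2`. -/
def branchNumber {d : ℕ} (μ : Composition d) : ℕ := μ.length + d - 2

/-- Single Hurwitz Dyck paths of type `μ`, where `μ` is an ordered partition of `d`. -/
structure SingleHurwitzDyckPath {d : ℕ} (μ : Composition d) extends MarkedDyckPath μ.length where
  isBDyck : IsBDyck (branchNumber μ) path
  isPrimitive : IsPrimitive path
  length_eq : path.toList.length = 2 * branchNumber μ * d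
  /-- The distinguished vertices are labelled; `dist k` is the one with label `k`. -/
  dist : Fin d → ℕ
  dist_injective : Function.Injective dist
  range_dist : Set.range dist = {x | IsDistinguished (branchNumber μ) path x}
  /-- The label of the marked pair formed by the two end points of the path. -/
  root : Fin μ.length
  left_root : left root = 0
  right_root : right root = 2 * branchNumber μ * d
  card_marked : (Set.range fun i => height path (left i) % (branchNumber μ + 1)).ncard = μ.length
  card_distinguished : ((fun x => height path x % (branchNumber μ + 1)) ''
    {x | IsDistinguished (branchNumber μ) path x}).ncard = d
  disjoint_heights : Disjoint
    {r | ∃ i, height path (left i) ≠ 0 ∧ r = height path (left i) % (branchNumber μ + 1)}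
    {r | ∃ x, IsDistinguished (branchNumber μ) path x ∧ height path x ≠ 0 ∧
      r = height path x % (branchNumber μ + 1)}
  noncrossing : ∀ i j, ¬ (left i < left j ∧ left j < right i ∧ right i < right j)
  degree_eq : ∀ i, toMarkedDyckPath.degree (branchNumber μ) i = μ.blocksFun i

namespace SingleHurwitzDyckPath

variable {d : ℕ} {μ : Composition d} (D : SingleHurwitzDyckPath μ)

/-! ### The galaxy of a path

The path describes the boundary of a cactus, traversed counterclockwise: up-steps are its black boundary
edges, down-steps its white boundary edges. The `b` up-steps that start at the distinguished vertex with
label `k`, followed by one internal edge that leads back from their end to the distinguished vertex,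
bound the black polygon labelled `k`. The white polygon labelled `i` is bounded by the down-steps in the
essential interval of the `i`-th marked pair and by the internal edges of the black polygons that start in
this interval; down-steps and internal edges are met in anticlockwise order around it. The two vertices of
a marked pair are one vertex of the cactus. The galaxy arises by gluing along horizontal lines below
the path: every up-step is glued to its matching down-step.

So the galaxy has the edges `(k, j)`, where for `j < b` the edge `(k, j)` is the `j`-th up-step after the
distinguished vertex `dist k`, glued to its matching down-step, and `(k, b)` is the internal edge. -/

/-- The part of the path that runs along the white side of an edge: its first lattice point. -/
noncomputable def whiteStart (e : Fin d × Fin (branchNumber μ + 1)) : ℕ :=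
  if (e.2 : ℕ) < branchNumber μ then matchingDown D.path (D.dist e.1 + e.2) else D.dist e.1

/-- The part of the path that runs along the white side of an edge: its last lattice point. -/
noncomputable def whiteEnd (e : Fin d × Fin (branchNumber μ + 1)) : ℕ :=
  if (e.2 : ℕ) < branchNumber μ then matchingDown D.path (D.dist e.1 + e.2) + 1
  else D.dist e.1 + branchNumber μ

/-- Arriving at the lattice point `p` along a white polygon, one goes on along the same white polygon from
the lattice point `q`: this is the partner of `p` if `p` is marked, and `p` itself otherwise. -/
def Continues (p q : ℕ) : Prop :=
  (∃ i, p = D.left i ∧ q = D.right i) ∨ (∃ i, p = D.right i ∧ q = D.left i) ∨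
    (p = q ∧ ∀ i, ¬ D.Marks i p)

open Classical in
/-- The edge clockwise after `e` on its white polygon. It exists and is unique; as the path meets the
edges of a white polygon anticlockwise, it is the edge that the path meets just before `e`. -/
noncomputable def whiteNext (e : Fin d × Fin (branchNumber μ + 1)) :
    Fin d × Fin (branchNumber μ + 1) :=
  if h : ∃ f, D.Continues (D.whiteEnd f) (D.whiteStart e) then h.choose else e

open Classical in
/-- The label of the white polygon that contains `e`: the marked pair whose essential interval contains
the white side of `e` (it exists and is unique). -/
noncomputable def whiteIndex (e : Fin d × Fin (branchNumber μ + 1)) : Fin μ.length :=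
  if h : ∃ i, D.InEssential i (D.whiteStart e) then h.choose else D.root

/-- The galaxy of a single Hurwitz Dyck path. The colour of a vertex is its height modulo `b + 1`. -/
noncomputable def galaxy :
    FaceColouredMap (branchNumber μ) μ.length (Composition.ones d).length where
  Edge := Fin d × Fin (branchNumber μ + 1)
  white := D.whiteNext
  black e := (e.1, e.2 + 1)
  colour e := (height D.path (D.dist e.1) : ZMod (branchNumber μ + 1)) + ((e.2 : ℕ) : ZMod _) + 1
  whiteLabel := D.whiteIndex
  blackLabel e := Fin.cast (Composition.ones_length d).symm e.1

/-- `D` is pruned if it gives rise to a pruned Hurwitz galaxy. -/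
def IsPruned : Prop := IsPrunedHurwitzGalaxy 0 μ D.galaxy

/-- Every sequence of `b` consecutive down-steps that begins at a peak contains a vertex of a marked
pair. -/
def DescentCondition : Prop :=
  ∀ x, IsUp D.path x → (∀ j < branchNumber μ, IsDown D.path (x + 1 + j)) →
    ∃ i p, D.Marks i p ∧ x + 1 ≤ p ∧ p ≤ x + 1 + branchNumber μ

/-- `v` is a distinguished vertex of lowest nonzero height. -/
def IsLowestDistinguished (v : ℕ) : Prop :=
  (IsDistinguished (branchNumber μ) D.path v ∧ height D.path v ≠ 0) ∧
    ∀ u, IsDistinguished (branchNumber μ) D.path u → height D.path u ≠ 0 →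
      height D.path v ≤ height D.path u

/-- `v` is the second distinguished vertex: the only one to the left of it is the origin. -/
def IsSecondDistinguished (v : ℕ) : Prop :=
  IsDistinguished (branchNumber μ) D.path v ∧
    {u | IsDistinguished (branchNumber μ) D.path u ∧ u < v} = {0}

/-- The distinguished vertex `v` of lowest nonzero height is not the second distinguished vertex, or there
is a vertex to the left of `v` that belongs to a marked pair other than the pair of end points. -/
def LowestDistinguishedVertexCondition : Prop :=
  ∃ v, D.IsLowestDistinguished v ∧
    (¬ D.IsSecondDistinguished v ∨ ∃ i p, i ≠ D.root ∧ D.Marks i p ∧ p < v)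

end SingleHurwitzDyckPath

end Hurwitz

/-! Cut the path at its nodes, the points with a multiple of b up-steps before them. Each piece
between consecutive nodes is one down-step or one block of b up-steps, and these pieces are exactly
the white sides of the edges: a down-step belongs to the edge of its matching up-step, a block to
the internal edge of its polygon. As b = -1 modulo b + 1, each piece lowers the height by 1 modulo b
+ 1, which makes the colouring consistent. An edge runs against the path, from the end of its white
side to the start, and the white permutation passes to the preceding piece after applying the
involution `partner` that swaps the points of each marked pair.

Vertices are the orbits of `rotate`, the black permutation followed by the inverse of the white one.
It preserves colours. It fixes the edge of an up-step unless the matching down-step starts at a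
marked point or a distinguished vertex is met first. Apart from the residue 0 of the root pair and
the origin, marked pairs and distinguished vertices have (ℓ - 1) + (d - 1) = b distinct nonzero
residues, so each nonzero colour is used by exactly one of them. Hence `rotate` is a single
transposition on each nonzero colour (`exists_transposition`) and the identity on colour 0. This
gives the valencies and d + b(d - 1) vertices; with ℓ white faces, d black faces and d(b + 1) edges
the Euler characteristic is 2. Because marked pairs do not cross, a white face is determined by the
innermost pair around it, and summing the height changes around it gives its perimeter
(`ncard_whiteIndex`).

A black face is a bubble if and only if `rotate` moves exactly one of its edges. Away from the
origin the internal edge always moves, so a bubble means that nothing else does: the block is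
followed by b down-steps without marked points, which violates the descent condition. At the origin
the internal edge is fixed, but the edges whose heads have the heights of the second and of the
lowest distinguished vertex move. So a bubble requires these vertices to coincide, with no non-root
marked point before them; conversely, nothing below the lowest distinguished vertex can then move an
edge. -/

namespace Hurwitz

/-! ### Dyck words: heights and matching steps. -/

section DyckWord

variable {w : DyckWord} {x y u v : ℕ}

lemma IsUp.lt_length (h : IsUp w x) : x < w.toList.length :=
  (List.getElem?_eq_some_iff.1 h).1

lemma IsDown.lt_length (h : IsDown w x) : x < w.toList.length :=
  (List.getElem?_eq_some_iff.1 h).1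

lemma IsDown.not_isUp (h : IsDown w x) : ¬ IsUp w x := by
  intro h'
  unfold IsUp at h'
  unfold IsDown at h
  simp_all

lemma isDown_of_not_isUp (hx : x < w.toList.length) (h : ¬ IsUp w x) : IsDown w x := by
  unfold IsUp at h
  unfold IsDown
  rw [List.getElem?_eq_getElem hx] at *
  cases hs : w.toList[x] <;> simp_all

lemma upsBefore_zero : upsBefore w 0 = 0 := by simp [upsBefore]

lemma height_zero : height w 0 = 0 := by simp [height, upsBefore]

lemma height_length : height w w.toList.length = 0 := by
  simp [height, upsBefore, w.count_U_eq_count_D]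

lemma IsUp.upsBefore_succ (h : IsUp w x) : upsBefore w (x + 1) = upsBefore w x + 1 := by
  unfold IsUp at h
  simp [upsBefore, List.take_add_one, h]

lemma upsBefore_succ_of_not_isUp (h : ¬ IsUp w x) : upsBefore w (x + 1) = upsBefore w x := by
  unfold IsUp at h
  rw [upsBefore, upsBefore, List.take_add_one, List.count_append]
  cases hs : w.toList[x]? with
  | none => simp
  | some s => cases s <;> simp_all

lemma IsUp.height_succ (h : IsUp w x) : height w (x + 1) = height w x + 1 := by
  have h1 := h.upsBefore_succ
  have h2 := w.count_D_le_count_U x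
  unfold IsUp at h
  have h3 : (w.toList.take (x + 1)).count DyckStep.D = (w.toList.take x).count DyckStep.D := by
    simp [List.take_add_one, h]
  unfold height
  unfold upsBefore at *
  omega

lemma IsDown.height_eq (h : IsDown w x) : height w x = height w (x + 1) + 1 := by
  have h1 := upsBefore_succ_of_not_isUp h.not_isUp
  have h2 := w.count_D_le_count_U (x + 1)
  unfold IsDown at h
  have h3 : (w.toList.take (x + 1)).count DyckStep.D =
      (w.toList.take x).count DyckStep.D + 1 := by
    simp [List.take_add_one, h]
  unfold height
  unfold upsBefore at *
  omega

lemma isUp_of_height_lt (hx : x < w.toList.length) (h : height w x < height w (x + 1)) :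
    IsUp w x := by
  by_contra hn
  have := (isDown_of_not_isUp hx hn).height_eq
  omega

lemma isDown_of_height_lt (hx : x < w.toList.length) (h : height w (x + 1) < height w x) :
    IsDown w x := by
  refine isDown_of_not_isUp hx fun hn => ?_
  have := hn.height_succ
  omega

/-- The matching down-step is the only down-step at the same level before which the path stays
above this level. -/
lemma matchingDown_eq (huy : u < y) (hy : IsDown w y) (hh : height w y = height w (u + 1))
    (hge : ∀ z, u < z → z ≤ y → height w (u + 1) ≤ height w z) : matchingDown w u = y := by
  have hmem : y ∈ {y | u < y ∧ IsDown w y ∧ height w y = height w (u + 1)} := ⟨huy, hy, hh⟩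
  have hle : matchingDown w u ≤ y := Nat.sInf_le hmem
  obtain ⟨h1, h2, h3⟩ := Nat.sInf_mem ⟨y, hmem⟩
  change u < matchingDown w u at h1
  change IsDown w (matchingDown w u) at h2
  change height w (matchingDown w u) = _ at h3
  by_contra hne
  have := hge (matchingDown w u + 1) (by omega) (by omega)
  have := h2.height_eq
  omega

/-- The path ends at height 0, so it must drop below the end of the up-step; the first step that
does so is the match. -/
lemma exists_matchingDown (hu : IsUp w u) :
    ∃ y, u < y ∧ IsDown w y ∧ height w y = height w (u + 1) ∧
      ∀ z, u < z → z ≤ y → height w (u + 1) ≤ height w z := by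
  have hL := hu.lt_length
  have hex : ∃ y, u < y ∧ height w (y + 1) < height w (u + 1) := by
    by_cases h : u + 1 < w.toList.length
    · refine ⟨w.toList.length - 1, by omega, ?_⟩
      rw [Nat.sub_add_cancel (by omega), height_length, hu.height_succ]
      omega
    · exfalso
      have h1 : u + 1 = w.toList.length := by omega
      have := hu.height_succ
      rw [h1, height_length] at this
      omega
  classical
  obtain ⟨h1, h2⟩ := Nat.find_spec hex
  set y := Nat.find hex
  have hmin : ∀ z, u < z → z ≤ y → height w (u + 1) ≤ height w z := by
    intro z hz hzy
    by_contra hlt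
    obtain ⟨z, rfl⟩ : ∃ z', z = z' + 1 := ⟨z - 1, by omega⟩
    have : u ≠ z := by rintro rfl; omega
    exact Nat.find_min hex (m := z) (by omega) ⟨by omega, by omega⟩
  have hyL : y < w.toList.length := by
    by_contra hn
    have := hmin w.toList.length (by omega) (by omega)
    rw [height_length, hu.height_succ] at this
    omega
  have hd : IsDown w y := isDown_of_height_lt hyL (by have := hmin y h1 le_rfl; omega)
  refine ⟨y, h1, hd, ?_, hmin⟩
  have := hd.height_eq
  have := hmin y h1 le_rfl
  omega

lemma IsUp.matchingDown_spec (hu : IsUp w u) :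
    u < matchingDown w u ∧ IsDown w (matchingDown w u) ∧
      height w (matchingDown w u) = height w (u + 1) ∧
      ∀ z, u < z → z ≤ matchingDown w u → height w (u + 1) ≤ height w z := by
  obtain ⟨y, h1, h2, h3, h4⟩ := exists_matchingDown hu
  rw [matchingDown_eq h1 h2 h3 h4]
  exact ⟨h1, h2, h3, h4⟩

/-- Between an up-step and its match the path stays at or above the level where the up-step ends, so
an up-step in between ends strictly higher and cannot share the match. -/
lemma matchingDown_injOn (hu : IsUp w u) (hv : IsUp w v)
    (h : matchingDown w u = matchingDown w v) : u = v := by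
  wlog huv : u < v generalizing u v
  · rcases lt_trichotomy u v with h' | h' | h'
    · exact this hu hv h h'
    · exact h'
    · exact (this hv hu h.symm h').symm
  exfalso
  obtain ⟨-, -, h3, h4⟩ := hu.matchingDown_spec
  obtain ⟨g1, -, g3, -⟩ := hv.matchingDown_spec
  have := h4 v huv (by omega)
  have := hv.height_succ
  rw [h] at h3
  omega

/-- The last earlier point strictly below the start of the down-step starts the required up-step;
the origin ensures that there is such a point. -/
lemma IsDown.exists_matchingDown_eq (hy : IsDown w y) :
    ∃ u, IsUp w u ∧ matchingDown w u = y := by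
  classical
  have hh := hy.height_eq
  have hL := hy.lt_length
  have hP : height w 0 < height w y := by rw [height_zero]; omega
  have h1 : height w (Nat.findGreatest (fun u => height w u < height w y) y) < height w y :=
    Nat.findGreatest_spec (P := fun u => height w u < height w y) (Nat.zero_le y) hP
  have h2 := Nat.findGreatest_le (P := fun u => height w u < height w y) y
  have h3 : ∀ z, Nat.findGreatest (fun u => height w u < height w y) y < z → z ≤ y →
      height w y ≤ height w z := fun z hz hzy =>
    not_lt.1 (Nat.findGreatest_is_greatest
      (P := fun u => height w u < height w y) hz hzy)
  set u := Nat.findGreatest (fun u => height w u < height w y) y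
  have huy : u < y := lt_of_le_of_ne h2 fun h => by rw [h] at h1; omega
  have h4 := h3 (u + 1) (by omega) (by omega)
  have hu : IsUp w u := isUp_of_height_lt (by omega) (by omega)
  have := hu.height_succ
  have h5 : height w (u + 1) = height w y := by omega
  exact ⟨u, hu, matchingDown_eq huy hy h5.symm fun z hz hzy => h5 ▸ h3 z hz hzy⟩

/-! ### Blocks of `b` up-steps -/

variable {b : ℕ}

lemma upsBefore_add_of_isUp (h : ∀ i < y, IsUp w (x + i)) :
    upsBefore w (x + y) = upsBefore w x + y := by
  induction y with
  | zero => rfl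
  | succ y ih =>
    rw [← add_assoc, (h y (by omega)).upsBefore_succ, ih fun i hi => h i (by omega)]
    omega

lemma height_add_of_isUp (h : ∀ i < y, IsUp w (x + i)) :
    height w (x + y) = height w x + y := by
  induction y with
  | zero => rfl
  | succ y ih =>
    rw [← add_assoc, (h y (by omega)).height_succ, ih fun i hi => h i (by omega)]
    omega

lemma exists_start_of_run (x : ℕ) :
    ∃ y ≤ x, (∀ z, y ≤ z → z < x → IsUp w z) ∧ ∀ z, y = z + 1 → ¬ IsUp w z := by
  induction x with
  | zero => exact ⟨0, le_rfl, by omega, by omega⟩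
  | succ x ih =>
    by_cases hx : IsUp w x
    · obtain ⟨y, h1, h2, h3⟩ := ih
      refine ⟨y, by omega, fun z hz hzx => ?_, h3⟩
      rcases Nat.lt_succ_iff_lt_or_eq.1 hzx with h | rfl
      · exact h2 z hz h
      · exact hx
    · refine ⟨x + 1, le_rfl, by omega, fun z hz => ?_⟩
      obtain rfl : x = z := by omega
      exact hx

/-- The maximal run of up-steps that ends at `x`, possibly empty, contributes a multiple of b;
before it comes the origin or an earlier step that is not up, to which induction applies. -/
lemma IsBDyck.dvd_upsBefore (hb : IsBDyck b w) (hx : ¬ IsUp w x) : b ∣ upsBefore w x := by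
  induction x using Nat.strong_induction_on with
  | _ x ih =>
    obtain ⟨y, h1, h2, h3⟩ := exists_start_of_run (w := w) x
    have hy : b ∣ upsBefore w y := by
      rcases y with _ | y
      · rw [upsBefore_zero]; exact dvd_zero b
      · rw [upsBefore_succ_of_not_isUp (h3 y rfl)]
        exact ih y (by omega) (h3 y rfl)
    rcases h1.eq_or_lt with rfl | h1
    · exact hy
    · have h4 := upsBefore_add_of_isUp (w := w) (x := y) (y := x - y)
        fun i hi => h2 _ (by omega) (by omega)
      rw [show y + (x - y) = x by omega] at h4
      rw [h4]
      exact dvd_add hy (hb.2.2 y x h1 h2 hx h3)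

/-- A run that stopped after fewer than b further steps would stop at a number of up-steps not
divisible by b. -/
lemma IsBDyck.isUp_add (hb : IsBDyck b w) (hx : IsDistinguished b w x) {j : ℕ} (hj : j < b) :
    IsUp w (x + j) := by
  induction j using Nat.strong_induction_on with
  | _ j ih =>
    by_contra hn
    have h1 := hb.dvd_upsBefore hn
    rw [upsBefore_add_of_isUp fun i hi => ih i hi (by omega), Nat.dvd_add_right hx.1] at h1
    rcases Nat.eq_zero_or_pos j with rfl | h
    · exact hn hx.2
    · exact absurd (Nat.le_of_dvd h h1) (by omega)

lemma IsBDyck.isDistinguished_of_not_isUp (hb : IsBDyck b w) (hx : IsUp w (x + 1))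
    (hn : ¬ IsUp w x) : IsDistinguished b w (x + 1) :=
  ⟨by rw [upsBefore_succ_of_not_isUp hn]; exact hb.dvd_upsBefore hn, hx⟩

lemma IsBDyck.exists_block (hb : IsBDyck b w) (hu : IsUp w u) :
    ∃ x j, IsDistinguished b w x ∧ j < b ∧ u = x + j := by
  induction u with
  | zero => exact ⟨0, 0, ⟨by rw [upsBefore_zero]; exact dvd_zero b, hu⟩, hb.1, rfl⟩
  | succ u ih =>
    by_cases hd : b ∣ upsBefore w (u + 1)
    · exact ⟨u + 1, 0, ⟨hd, hu⟩, hb.1, rfl⟩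
    · have hu' : IsUp w u := by
        by_contra hn
        exact hd (hb.isDistinguished_of_not_isUp hu hn).1
      obtain ⟨x, j, hx, hj, rfl⟩ := ih hu'
      refine ⟨x, j + 1, hx, lt_of_le_of_ne hj fun h => hd ?_, rfl⟩
      rw [add_assoc, upsBefore_add_of_isUp fun i hi => hb.isUp_add hx (by omega), h]
      exact dvd_add hx.1 dvd_rfl

/-- The offset inside a block is the number of preceding up-steps modulo b. Together with
`exists_block`, this partitions the up-steps into blocks. -/
lemma IsBDyck.block_unique (hb : IsBDyck b w) (hx : IsDistinguished b w x)
    (hy : IsDistinguished b w y) {i j : ℕ} (hi : i < b) (hj : j < b) (h : x + i = y + j) :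
    x = y ∧ i = j := by
  have h1 := upsBefore_add_of_isUp (w := w) (x := x) (y := i) fun n hn => hb.isUp_add hx (by omega)
  have h2 := upsBefore_add_of_isUp (w := w) (x := y) (y := j) fun n hn => hb.isUp_add hy (by omega)
  obtain ⟨p, hp⟩ := hx.1
  obtain ⟨q, hq⟩ := hy.1
  rw [h, h2, hp, hq] at h1
  have h3 : j % b = i % b := by
    rw [← Nat.mul_add_mod b q j, ← Nat.mul_add_mod b p i, h1]
  rw [Nat.mod_eq_of_lt hi, Nat.mod_eq_of_lt hj] at h3
  omega

/-- After a down-step, the path rises only after a distinguished vertex. -/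
lemma IsBDyck.exists_isDistinguished_of_height_lt (hb : IsBDyck b w) (hx : ¬ IsUp w x)
    (hxy : x < y) (hyL : y ≤ w.toList.length) (hh : height w (x + 1) < height w y) :
    ∃ p, x < p ∧ p < y ∧ IsDistinguished b w p ∧ height w p ≤ height w (x + 1) := by
  induction h : y - x generalizing x with
  | zero => omega
  | succ n ih =>
    have hne : x + 1 ≠ y := by rintro rfl; omega
    by_cases hu : IsUp w (x + 1)
    · exact ⟨x + 1, by omega, by omega, hb.isDistinguished_of_not_isUp hu hx, le_rfl⟩
    · have := (isDown_of_not_isUp (by omega) hu).height_eq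
      obtain ⟨p, h1, h2, h3, h4⟩ := ih hu (by omega) (by omega) (by omega)
      exact ⟨p, by omega, h2, h3, by omega⟩

end DyckWord

/-! ### Distinguished vertices and blocks of a single Hurwitz Dyck path. -/

namespace SingleHurwitzDyckPath

variable {d : ℕ} {μ : Composition d} (D : SingleHurwitzDyckPath μ)

lemma branchNumber_pos (D : SingleHurwitzDyckPath μ) : 0 < branchNumber μ := D.isBDyck.1

lemma isDistinguished_dist (k : Fin d) : IsDistinguished (branchNumber μ) D.path (D.dist k) := by
  have : D.dist k ∈ Set.range D.dist := ⟨k, rfl⟩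
  rwa [D.range_dist] at this

lemma exists_dist_eq {x : ℕ} (hx : IsDistinguished (branchNumber μ) D.path x) :
    ∃ k, D.dist k = x := by
  have : x ∈ Set.range D.dist := by rwa [D.range_dist]
  exact this

lemma isUp_dist_add (k : Fin d) {j : ℕ} (hj : j < branchNumber μ) :
    IsUp D.path (D.dist k + j) :=
  D.isBDyck.isUp_add (D.isDistinguished_dist k) hj

lemma height_dist_add (k : Fin d) {j : ℕ} (hj : j ≤ branchNumber μ) :
    height D.path (D.dist k + j) = height D.path (D.dist k) + j :=
  height_add_of_isUp fun _ hi => D.isUp_dist_add k (by omega)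

lemma upsBefore_dist_add (k : Fin d) {j : ℕ} (hj : j ≤ branchNumber μ) :
    upsBefore D.path (D.dist k + j) = upsBefore D.path (D.dist k) + j :=
  upsBefore_add_of_isUp fun _ hi => D.isUp_dist_add k (by omega)

lemma d_pos (D : SingleHurwitzDyckPath μ) : 0 < d := by
  have h := D.right_root
  have h1 := D.left_lt_right D.root
  rw [h] at h1
  refine Nat.pos_of_ne_zero fun h0 => ?_
  have := mul_eq_zero_of_right (2 * branchNumber μ) h0
  omega

lemma length_pos : 0 < D.path.toList.length := by
  have h1 := D.left_lt_right D.root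
  rw [D.right_root, ← D.length_eq] at h1
  omega

lemma right_root_eq : D.right D.root = D.path.toList.length := by
  rw [D.right_root, D.length_eq]

lemma height_root : height D.path (D.left D.root) = 0 := by rw [D.left_root, height_zero]

/-! ### Residues of heights -/

lemma left_residue_injective :
    Function.Injective fun i => height D.path (D.left i) % (branchNumber μ + 1) := by
  have h := D.card_marked
  rw [← Set.image_univ] at h
  refine Set.injOn_univ.1 (Set.injOn_of_ncard_image_eq ?_ Set.finite_univ)
  rw [h, Set.ncard_univ, Nat.card_eq_fintype_card, Fintype.card_fin]

lemma dist_residue_injective :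
    Function.Injective fun k => height D.path (D.dist k) % (branchNumber μ + 1) := by
  have h := D.card_distinguished
  rw [← D.range_dist, ← Set.range_comp, ← Set.image_univ] at h
  refine Set.injOn_univ.1 (Set.injOn_of_ncard_image_eq ?_ Set.finite_univ)
  have h' : ((fun k => height D.path (D.dist k) % (branchNumber μ + 1)) '' Set.univ).ncard = d := h
  rw [h', Set.ncard_univ, Nat.card_eq_fintype_card, Fintype.card_fin]

lemma eq_of_height_left_eq {i j : Fin μ.length}
    (h : height D.path (D.left i) = height D.path (D.left j)) : i = j :=
  D.left_residue_injective (by simp only [h])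

lemma eq_of_height_dist_eq {k l : Fin d}
    (h : height D.path (D.dist k) = height D.path (D.dist l)) : k = l :=
  D.dist_residue_injective (by simp only [h])

lemma isUp_zero : IsUp D.path 0 := by
  by_contra hn
  have := (isDown_of_not_isUp D.length_pos hn).height_eq
  rw [height_zero] at this
  omega

lemma isDistinguished_zero : IsDistinguished (branchNumber μ) D.path 0 :=
  ⟨by rw [upsBefore_zero]; exact dvd_zero _, D.isUp_zero⟩

lemma exists_dist_eq_zero : ∃ k, D.dist k = 0 := D.exists_dist_eq D.isDistinguished_zero

lemma dist_eq_zero_iff {k : Fin d} : D.dist k = 0 ↔ height D.path (D.dist k) = 0 := by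
  constructor
  · intro h; rw [h, height_zero]
  · intro h
    obtain ⟨l, hl⟩ := D.exists_dist_eq_zero
    rw [D.eq_of_height_dist_eq (k := k) (l := l) (by rw [h, hl, height_zero]), hl]

/-- Only the origin and the end point lie on the axis. -/
lemma height_pos {x : ℕ} (h0 : 0 < x) (hL : x < D.path.toList.length) : 0 < height D.path x := by
  by_contra hn
  have hx : height D.path x = 0 := by omega
  obtain ⟨x, rfl⟩ : ∃ y, x = y + 1 := ⟨x - 1, by omega⟩
  have h1 : ¬ IsUp D.path x := fun hu => by have := hu.height_succ; omega
  -- An up-step from here would make this point distinguished at height 0, like the origin, against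
  -- the distinctness of residues; a down-step would go below the axis.
  by_cases hu : IsUp D.path (x + 1)
  · obtain ⟨k, hk⟩ := D.exists_dist_eq (D.isBDyck.isDistinguished_of_not_isUp hu h1)
    have := D.dist_eq_zero_iff.2 (by rw [hk, hx])
    omega
  · have := (isDown_of_not_isUp hL hu).height_eq
    omega

lemma residue_eq_zero_left {i : Fin μ.length}
    (h : height D.path (D.left i) % (branchNumber μ + 1) = 0) : i = D.root :=
  D.left_residue_injective (by simp only [h, D.height_root, Nat.zero_mod])

lemma residue_eq_zero_dist {k : Fin d}
    (h : height D.path (D.dist k) % (branchNumber μ + 1) = 0) : D.dist k = 0 := by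
  obtain ⟨l, hl⟩ := D.exists_dist_eq_zero
  rw [D.dist_residue_injective (a₁ := k) (a₂ := l) (by simp only [h, hl, height_zero, Nat.zero_mod]),
    hl]

/-- Disjointness is assumed only for nonzero heights. The root pair is covered too, because residue
0 among distinguished vertices occurs only at the origin. -/
lemma residue_left_ne_dist {i : Fin μ.length} {k : Fin d} (hk : D.dist k ≠ 0) :
    height D.path (D.left i) % (branchNumber μ + 1) ≠
      height D.path (D.dist k) % (branchNumber μ + 1) := by
  intro h
  have hk0 : height D.path (D.dist k) ≠ 0 := fun h => hk (D.dist_eq_zero_iff.2 h)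
  have hi : height D.path (D.left i) ≠ 0 := by
    intro h0
    rw [h0, Nat.zero_mod] at h
    exact hk (D.residue_eq_zero_dist h.symm)
  exact Set.disjoint_left.1 D.disjoint_heights ⟨i, hi, rfl⟩
    ⟨D.dist k, D.isDistinguished_dist k, hk0, h⟩

lemma branchNumber_add_two (D : SingleHurwitzDyckPath μ) : branchNumber μ + 2 = μ.length + d := by
  have h := D.branchNumber_pos
  unfold branchNumber at *
  omega

lemma one_le_length (D : SingleHurwitzDyckPath μ) : 1 ≤ μ.length := by
  have := D.root.isLt
  omega

/-- Every nonzero residue is the residue of the height of a marked pair or of a distinguished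
vertex. -/
lemma exists_residue_eq {r : ℕ} (hr0 : r ≠ 0) (hr : r < branchNumber μ + 1) :
    (∃ i, i ≠ D.root ∧ height D.path (D.left i) % (branchNumber μ + 1) = r) ∨
      ∃ k, D.dist k ≠ 0 ∧ height D.path (D.dist k) % (branchNumber μ + 1) = r := by
  classical
  obtain ⟨k0, hk0⟩ := D.exists_dist_eq_zero
  set A : Finset ℕ := (Finset.univ.erase D.root).image
    fun i => height D.path (D.left i) % (branchNumber μ + 1) with hA
  set B : Finset ℕ := (Finset.univ.erase k0).image
    fun k => height D.path (D.dist k) % (branchNumber μ + 1) with hB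
  have hne : ∀ k, k ≠ k0 → D.dist k ≠ 0 := fun k hk h => hk (D.dist_injective (h.trans hk0.symm))
  have hAc : A.card = μ.length - 1 := by
    rw [hA, Finset.card_image_of_injective _ D.left_residue_injective,
      Finset.card_erase_of_mem (Finset.mem_univ _), Finset.card_univ, Fintype.card_fin]
  have hBc : B.card = d - 1 := by
    rw [hB, Finset.card_image_of_injective _ D.dist_residue_injective,
      Finset.card_erase_of_mem (Finset.mem_univ _), Finset.card_univ, Fintype.card_fin]
  have hdisj : Disjoint A B := by
    rw [Finset.disjoint_left]
    intro x hx hx'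
    obtain ⟨i, -, rfl⟩ := Finset.mem_image.1 hx
    obtain ⟨k, hk, hki⟩ := Finset.mem_image.1 hx'
    exact D.residue_left_ne_dist (hne k (Finset.ne_of_mem_erase hk)) hki.symm
  have hsub : A ∪ B ⊆ (Finset.range (branchNumber μ + 1)).erase 0 := by
    intro x hx
    rw [Finset.mem_erase, Finset.mem_range]
    rcases Finset.mem_union.1 hx with hx | hx
    · obtain ⟨i, hi, rfl⟩ := Finset.mem_image.1 hx
      exact ⟨fun h => Finset.ne_of_mem_erase hi (D.residue_eq_zero_left h),
        Nat.mod_lt _ (Nat.succ_pos _)⟩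
    · obtain ⟨k, hk, rfl⟩ := Finset.mem_image.1 hx
      exact ⟨fun h => hne k (Finset.ne_of_mem_erase hk) (D.residue_eq_zero_dist h),
        Nat.mod_lt _ (Nat.succ_pos _)⟩
  -- The two disjoint sets have (ℓ - 1) + (d - 1) = b elements in all, as many as there are nonzero
  -- residues.
  have heq := Finset.eq_of_subset_of_card_le hsub (by
    rw [Finset.card_erase_of_mem (by simp), Finset.card_range, Finset.card_union_of_disjoint hdisj,
      hAc, hBc]
    have := D.branchNumber_add_two
    have := D.one_le_length
    have := D.d_pos
    omega)
  have hmem : r ∈ A ∪ B := by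
    rw [heq, Finset.mem_erase, Finset.mem_range]
    exact ⟨hr0, hr⟩
  rcases Finset.mem_union.1 hmem with hx | hx
  · obtain ⟨i, hi, rfl⟩ := Finset.mem_image.1 hx
    exact Or.inl ⟨i, Finset.ne_of_mem_erase hi, rfl⟩
  · obtain ⟨k, hk, rfl⟩ := Finset.mem_image.1 hx
    exact Or.inr ⟨k, hne k (Finset.ne_of_mem_erase hk), rfl⟩

/-! ### Nodes: the end points of the parts of the path on white polygons -/

/-- The lattice points in which the white sides of edges end. -/
def IsNode (p : ℕ) : Prop := p ≤ D.path.toList.length ∧ branchNumber μ ∣ upsBefore D.path p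

lemma isNode_of_not_isUp {p : ℕ} (hp : p ≤ D.path.toList.length) (hn : ¬ IsUp D.path p) :
    D.IsNode p :=
  ⟨hp, D.isBDyck.dvd_upsBefore hn⟩

lemma isNode_succ {p : ℕ} (hp : IsDown D.path p) : D.IsNode (p + 1) :=
  ⟨hp.lt_length, by
    rw [upsBefore_succ_of_not_isUp hp.not_isUp]; exact D.isBDyck.dvd_upsBefore hp.not_isUp⟩

lemma isNode_dist (k : Fin d) : D.IsNode (D.dist k) :=
  ⟨(D.isDistinguished_dist k).2.lt_length.le, (D.isDistinguished_dist k).1⟩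

lemma dist_add_le_length (k : Fin d) {j : ℕ} (hj : j ≤ branchNumber μ) :
    D.dist k + j ≤ D.path.toList.length := by
  rcases j with _ | j
  · exact (D.isNode_dist k).1
  · exact (D.isUp_dist_add k hj).lt_length

lemma isNode_dist_add (k : Fin d) : D.IsNode (D.dist k + branchNumber μ) := by
  refine ⟨D.dist_add_le_length k le_rfl, ?_⟩
  rw [D.upsBefore_dist_add k le_rfl]
  exact dvd_add (D.isDistinguished_dist k).1 dvd_rfl

lemma isNode_of_isDownVertex {p : ℕ} (h : IsDownVertex D.path p) : D.IsNode p := by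
  rcases h with h | ⟨y, rfl, h⟩
  · exact D.isNode_of_not_isUp h.lt_length.le h.not_isUp
  · exact D.isNode_succ h

lemma isNode_left (i : Fin μ.length) : D.IsNode (D.left i) := by
  by_cases h : D.left i = 0
  · rw [h]
    exact ⟨Nat.zero_le _, D.isDistinguished_zero.1⟩
  · exact D.isNode_of_isDownVertex (D.left_down i h)

lemma isNode_right (i : Fin μ.length) : D.IsNode (D.right i) :=
  D.isNode_of_isDownVertex (D.right_down i)

/-! ### Marked vertices -/

/-- Different pairs lie at different heights, so no point belongs to two pairs; this makes `partner`
a well-defined involution. -/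
lemma left_ne_right (i j : Fin μ.length) : D.left i ≠ D.right j := by
  intro h
  have hij : i = j := D.eq_of_height_left_eq (by rw [h, D.height_eq j])
  have := D.left_lt_right j
  rw [hij] at h
  omega

lemma left_injective : Function.Injective D.left := fun i j h =>
  D.eq_of_height_left_eq (by rw [h])

lemma right_injective : Function.Injective D.right := fun i j h =>
  D.eq_of_height_left_eq (by rw [D.height_eq, D.height_eq, h])

lemma height_of_marks {i : Fin μ.length} {p : ℕ} (h : D.Marks i p) :
    height D.path p = height D.path (D.left i) := by
  rcases h with rfl | rfl
  · rfl
  · rw [D.height_eq]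

lemma height_left_pos {i : Fin μ.length} (hi : i ≠ D.root) : 0 < height D.path (D.left i) := by
  by_contra h
  exact hi (D.residue_eq_zero_left (by rw [show height D.path (D.left i) = 0 by omega, Nat.zero_mod]))

open Classical in
/-- The other point of the marked pair that contains `p`, and `p` itself if it is not marked. -/
noncomputable def partner (p : ℕ) : ℕ :=
  if h : ∃ i, p = D.left i then D.right h.choose
  else if h : ∃ i, p = D.right i then D.left h.choose else p

lemma partner_left (i : Fin μ.length) : D.partner (D.left i) = D.right i := by
  have h : ∃ j, D.left i = D.left j := ⟨i, rfl⟩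
  rw [partner, dif_pos h, ← D.left_injective h.choose_spec]

lemma partner_right (i : Fin μ.length) : D.partner (D.right i) = D.left i := by
  have h : ∃ j, D.right i = D.right j := ⟨i, rfl⟩
  have h' : ¬ ∃ j, D.right i = D.left j := fun ⟨j, hj⟩ => D.left_ne_right j i hj.symm
  rw [partner, dif_neg h', dif_pos h, ← D.right_injective h.choose_spec]

lemma partner_of_not_marks {p : ℕ} (h : ∀ i, ¬ D.Marks i p) : D.partner p = p := by
  rw [partner, dif_neg fun ⟨i, hi⟩ => h i (Or.inl hi), dif_neg fun ⟨i, hi⟩ => h i (Or.inr hi)]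

lemma continues_iff {p q : ℕ} : D.Continues p q ↔ q = D.partner p := by
  constructor
  · rintro (⟨i, rfl, rfl⟩ | ⟨i, rfl, rfl⟩ | ⟨rfl, h⟩)
    · rw [D.partner_left]
    · rw [D.partner_right]
    · rw [D.partner_of_not_marks h]
  · rintro rfl
    by_cases h : ∃ i, D.Marks i p
    · obtain ⟨i, rfl | rfl⟩ := h
      · exact Or.inl ⟨i, rfl, D.partner_left i⟩
      · exact Or.inr (Or.inl ⟨i, rfl, D.partner_right i⟩)
    · push Not at h
      exact Or.inr (Or.inr ⟨(D.partner_of_not_marks h).symm, h⟩)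

/-- A property that holds for marked pairs in both orders and for unmarked points holds for all points
and their partners. -/
lemma partner_cases {P : ℕ → ℕ → Prop} (h1 : ∀ i, P (D.left i) (D.right i))
    (h2 : ∀ i, P (D.right i) (D.left i)) (h3 : ∀ p, (∀ i, ¬ D.Marks i p) → P p p) (p : ℕ) :
    P p (D.partner p) := by
  rcases D.continues_iff.2 (rfl : D.partner p = _) with ⟨i, hp, hq⟩ | ⟨i, hp, hq⟩ | ⟨hp, h⟩
  · rw [hq, hp]; exact h1 i
  · rw [hq, hp]; exact h2 i
  · rw [← hp]; exact h3 p h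

lemma partner_partner (p : ℕ) : D.partner (D.partner p) = p :=
  D.partner_cases (P := fun p q => D.partner q = p) D.partner_right D.partner_left
    (fun _ h => D.partner_of_not_marks h) p

lemma partner_injective : Function.Injective D.partner :=
  Function.LeftInverse.injective D.partner_partner

lemma height_partner (p : ℕ) : height D.path (D.partner p) = height D.path p :=
  D.partner_cases (P := fun p q => height D.path q = height D.path p) (fun i => (D.height_eq i).symm)
    D.height_eq (fun _ _ => rfl) p

lemma isNode_partner {p : ℕ} (hp : D.IsNode p) : D.IsNode (D.partner p) :=
  D.partner_cases (P := fun p q => D.IsNode p → D.IsNode q) (fun i _ => D.isNode_right i)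
    (fun i _ => D.isNode_left i) (fun _ _ h => h) p hp

lemma partner_ne_of_marks {p : ℕ} {i : Fin μ.length} (h : D.Marks i p) : D.partner p ≠ p := by
  have := D.left_lt_right i
  rcases h with rfl | rfl
  · rw [D.partner_left]; omega
  · rw [D.partner_right]; omega

lemma partner_zero : D.partner 0 = D.path.toList.length := by
  rw [← D.right_root_eq, ← D.partner_left, D.left_root]

lemma partner_length : D.partner D.path.toList.length = 0 := by
  rw [← D.partner_zero, D.partner_partner]

lemma partner_pos {p : ℕ} (hp : p ≠ D.path.toList.length) : 0 < D.partner p :=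
  Nat.pos_of_ne_zero fun h => hp (D.partner_injective (h.trans D.partner_length.symm))

/-! ### The white sides of the edges -/

lemma whiteStart_of_lt {e : Fin d × Fin (branchNumber μ + 1)} (h : (e.2 : ℕ) < branchNumber μ) :
    D.whiteStart e = matchingDown D.path (D.dist e.1 + e.2) := if_pos h

lemma whiteEnd_of_lt {e : Fin d × Fin (branchNumber μ + 1)} (h : (e.2 : ℕ) < branchNumber μ) :
    D.whiteEnd e = D.whiteStart e + 1 := by
  rw [whiteEnd, if_pos h, D.whiteStart_of_lt h]

lemma whiteStart_of_eq {e : Fin d × Fin (branchNumber μ + 1)} (h : (e.2 : ℕ) = branchNumber μ) :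
    D.whiteStart e = D.dist e.1 := if_neg (by omega)

lemma whiteEnd_of_eq {e : Fin d × Fin (branchNumber μ + 1)} (h : (e.2 : ℕ) = branchNumber μ) :
    D.whiteEnd e = D.dist e.1 + branchNumber μ := if_neg (by omega)

lemma isDown_whiteStart {e : Fin d × Fin (branchNumber μ + 1)}
    (h : (e.2 : ℕ) < branchNumber μ) : IsDown D.path (D.whiteStart e) := by
  rw [D.whiteStart_of_lt h]
  exact (D.isUp_dist_add e.1 h).matchingDown_spec.2.1

lemma isUp_whiteStart {e : Fin d × Fin (branchNumber μ + 1)}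
    (h : (e.2 : ℕ) = branchNumber μ) : IsUp D.path (D.whiteStart e) := by
  rw [D.whiteStart_of_eq h]
  exact (D.isDistinguished_dist e.1).2

lemma snd_lt_or_eq (e : Fin d × Fin (branchNumber μ + 1)) :
    (e.2 : ℕ) < branchNumber μ ∨ (e.2 : ℕ) = branchNumber μ := by
  have := e.2.isLt
  omega

lemma whiteStart_lt_length (e : Fin d × Fin (branchNumber μ + 1)) :
    D.whiteStart e < D.path.toList.length := by
  rcases snd_lt_or_eq e with h | h
  · exact (D.isDown_whiteStart h).lt_length
  · exact (D.isUp_whiteStart h).lt_length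

lemma isNode_whiteStart (e : Fin d × Fin (branchNumber μ + 1)) : D.IsNode (D.whiteStart e) := by
  rcases snd_lt_or_eq e with h | h
  · exact D.isNode_of_not_isUp (D.whiteStart_lt_length e).le (D.isDown_whiteStart h).not_isUp
  · rw [D.whiteStart_of_eq h]
    exact D.isNode_dist e.1

lemma isNode_whiteEnd (e : Fin d × Fin (branchNumber μ + 1)) : D.IsNode (D.whiteEnd e) := by
  rcases snd_lt_or_eq e with h | h
  · rw [D.whiteEnd_of_lt h]
    exact D.isNode_succ (D.isDown_whiteStart h)
  · rw [D.whiteEnd_of_eq h]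
    exact D.isNode_dist_add e.1

lemma whiteStart_lt_whiteEnd (e : Fin d × Fin (branchNumber μ + 1)) :
    D.whiteStart e < D.whiteEnd e := by
  have := D.branchNumber_pos
  rcases snd_lt_or_eq e with h | h
  · rw [D.whiteEnd_of_lt h]; omega
  · rw [D.whiteEnd_of_eq h, D.whiteStart_of_eq h]; omega

/-- There are no nodes in the interior of the white side of an edge. -/
lemma whiteEnd_le_of_lt {e : Fin d × Fin (branchNumber μ + 1)} {p : ℕ} (hp : D.IsNode p)
    (h : D.whiteStart e < p) : D.whiteEnd e ≤ p := by
  rcases snd_lt_or_eq e with h' | h'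
  · rw [D.whiteEnd_of_lt h']; omega
  · rw [D.whiteEnd_of_eq h']
    rw [D.whiteStart_of_eq h'] at h
    by_contra hn
    obtain ⟨j, rfl⟩ : ∃ j, p = D.dist e.1 + j := ⟨p - D.dist e.1, by omega⟩
    have h2 := hp.2
    rw [D.upsBefore_dist_add e.1 (by omega),
      Nat.dvd_add_right (D.isDistinguished_dist e.1).1] at h2
    have := Nat.le_of_dvd (by omega) h2
    omega

/-- Matching is injective, blocks are disjoint, and a down-step cannot start where a block does.
With `exists_whiteStart_eq`, every node except the end of the path starts exactly one white side. -/
lemma whiteStart_injective : Function.Injective D.whiteStart := by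
  intro e f hef
  rcases snd_lt_or_eq e with he | he <;> rcases snd_lt_or_eq f with hf | hf
  · rw [D.whiteStart_of_lt he, D.whiteStart_of_lt hf] at hef
    obtain ⟨h1, h2⟩ := D.isBDyck.block_unique (D.isDistinguished_dist e.1)
      (D.isDistinguished_dist f.1) he hf
      (matchingDown_injOn (D.isUp_dist_add e.1 he) (D.isUp_dist_add f.1 hf) hef)
    exact Prod.ext (D.dist_injective h1) (Fin.ext h2)
  · exact absurd (hef ▸ D.isUp_whiteStart hf) (D.isDown_whiteStart he).not_isUp
  · exact absurd (hef ▸ D.isUp_whiteStart he) (D.isDown_whiteStart hf).not_isUp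
  · rw [D.whiteStart_of_eq he, D.whiteStart_of_eq hf] at hef
    exact Prod.ext (D.dist_injective hef) (Fin.ext (he.trans hf.symm))

lemma exists_whiteStart_eq_of_isDown {p : ℕ} (hp : IsDown D.path p) :
    ∃ e : Fin d × Fin (branchNumber μ + 1),
      (e.2 : ℕ) < branchNumber μ ∧ D.whiteStart e = p := by
  obtain ⟨u, hu, rfl⟩ := hp.exists_matchingDown_eq
  obtain ⟨x, j, hx, hj, rfl⟩ := D.isBDyck.exists_block hu
  obtain ⟨k, rfl⟩ := D.exists_dist_eq hx
  exact ⟨(k, ⟨j, by omega⟩), hj, D.whiteStart_of_lt (e := (k, ⟨j, by omega⟩)) hj⟩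

lemma exists_whiteStart_eq {p : ℕ} (hp : D.IsNode p) (hL : p < D.path.toList.length) :
    ∃ e, D.whiteStart e = p := by
  by_cases hu : IsUp D.path p
  · obtain ⟨k, rfl⟩ := D.exists_dist_eq ⟨hp.2, hu⟩
    exact ⟨(k, Fin.last _), D.whiteStart_of_eq rfl⟩
  · obtain ⟨e, -, he⟩ := D.exists_whiteStart_eq_of_isDown (isDown_of_not_isUp hL hu)
    exact ⟨e, he⟩

/-- Of two white sides with different starts, the earlier one ends no later than the other begins.
-/
lemma whiteEnd_injective : Function.Injective D.whiteEnd := by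
  intro e f hef
  apply D.whiteStart_injective
  rcases lt_trichotomy (D.whiteStart e) (D.whiteStart f) with h | h | h
  · have := D.whiteEnd_le_of_lt (D.isNode_whiteStart f) h
    have := D.whiteStart_lt_whiteEnd f
    omega
  · exact h
  · have := D.whiteEnd_le_of_lt (D.isNode_whiteStart e) h
    have := D.whiteStart_lt_whiteEnd e
    omega

lemma exists_whiteEnd_eq {p : ℕ} (hp : D.IsNode p) (h0 : 0 < p) : ∃ e, D.whiteEnd e = p := by
  obtain ⟨p, rfl⟩ : ∃ q, p = q + 1 := ⟨p - 1, by omega⟩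
  by_cases hu : IsUp D.path p
  · obtain ⟨x, j, hx, hj, rfl⟩ := D.isBDyck.exists_block hu
    obtain ⟨k, rfl⟩ := D.exists_dist_eq hx
    have h2 := hp.2
    rw [add_assoc, D.upsBefore_dist_add k (by omega), Nat.dvd_add_right hx.1] at h2
    have := Nat.le_of_dvd (by omega) h2
    have hjb : j + 1 = branchNumber μ := by omega
    refine ⟨(k, Fin.last _), ?_⟩
    rw [D.whiteEnd_of_eq rfl, add_assoc, hjb]
  · obtain ⟨e, he, h⟩ := D.exists_whiteStart_eq_of_isDown (isDown_of_not_isUp hp.1 hu)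
    exact ⟨e, by rw [D.whiteEnd_of_lt he, h]⟩

/-! ### Heights and colours -/

lemma height_whiteStart_of_lt {e : Fin d × Fin (branchNumber μ + 1)}
    (h : (e.2 : ℕ) < branchNumber μ) :
    height D.path (D.whiteStart e) = height D.path (D.dist e.1) + e.2 + 1 := by
  rw [D.whiteStart_of_lt h, (D.isUp_dist_add e.1 h).matchingDown_spec.2.2.1, add_assoc,
    D.height_dist_add e.1 h, add_assoc]

lemma height_whiteStart_of_eq {e : Fin d × Fin (branchNumber μ + 1)}
    (h : (e.2 : ℕ) = branchNumber μ) :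
    height D.path (D.whiteStart e) = height D.path (D.dist e.1) := by
  rw [D.whiteStart_of_eq h]

lemma height_whiteEnd_of_lt {e : Fin d × Fin (branchNumber μ + 1)}
    (h : (e.2 : ℕ) < branchNumber μ) :
    height D.path (D.whiteStart e) = height D.path (D.whiteEnd e) + 1 := by
  rw [D.whiteEnd_of_lt h]
  exact (D.isDown_whiteStart h).height_eq

lemma height_whiteEnd_of_eq {e : Fin d × Fin (branchNumber μ + 1)}
    (h : (e.2 : ℕ) = branchNumber μ) :
    height D.path (D.whiteEnd e) = height D.path (D.whiteStart e) + branchNumber μ := by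
  rw [D.whiteEnd_of_eq h, D.whiteStart_of_eq h, D.height_dist_add e.1 le_rfl]

lemma natCast_branchNumber_add_one : (branchNumber μ : ZMod (branchNumber μ + 1)) + 1 = 0 := by
  exact_mod_cast ZMod.natCast_self (branchNumber μ + 1)

/-- The colour of the head of an edge. -/
noncomputable def edgeColour (e : Fin d × Fin (branchNumber μ + 1)) : ZMod (branchNumber μ + 1) :=
  D.galaxy.colour e

/-- An edge points at the start of its white side: a matching down-step starts where its up-step
ends, and an internal edge returns to the distinguished vertex. -/
lemma colour_eq (e : Fin d × Fin (branchNumber μ + 1)) :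
    D.edgeColour e = (height D.path (D.whiteStart e) : ZMod (branchNumber μ + 1)) := by
  change (height D.path (D.dist e.1) : ZMod (branchNumber μ + 1)) + ((e.2 : ℕ) : ZMod _) + 1 = _
  rcases snd_lt_or_eq e with h | h
  · rw [D.height_whiteStart_of_lt h]; push_cast; rfl
  · rw [D.height_whiteStart_of_eq h, h, add_assoc, natCast_branchNumber_add_one, add_zero]

lemma colour_eq_whiteEnd (e : Fin d × Fin (branchNumber μ + 1)) :
    D.edgeColour e = (height D.path (D.whiteEnd e) : ZMod (branchNumber μ + 1)) + 1 := by
  rw [D.colour_eq]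
  rcases snd_lt_or_eq e with h | h
  · rw [D.height_whiteEnd_of_lt h]; push_cast; rfl
  · rw [D.height_whiteEnd_of_eq h]
    push_cast
    rw [add_assoc, natCast_branchNumber_add_one, add_zero]

lemma natCast_eq_natCast_iff_mod {m n c : ℕ} : ((m : ZMod (c + 1)) = n) ↔ m % (c + 1) = n % (c + 1) :=
  ZMod.natCast_eq_natCast_iff' m n (c + 1)

lemma colour_injOn_blackFace {e f : Fin d × Fin (branchNumber μ + 1)} (h1 : e.1 = f.1)
    (h : D.edgeColour e = D.edgeColour f) : e = f := by
  change (height D.path (D.dist e.1) : ZMod (branchNumber μ + 1)) + ((e.2 : ℕ) : ZMod _) + 1 =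
    (height D.path (D.dist f.1) : ZMod (branchNumber μ + 1)) + ((f.2 : ℕ) : ZMod _) + 1 at h
  rw [h1, add_left_inj, add_right_inj, natCast_eq_natCast_iff_mod, Nat.mod_eq_of_lt e.2.isLt,
    Nat.mod_eq_of_lt f.2.isLt] at h
  exact Prod.ext h1 (Fin.ext h)

lemma exists_colour_eq (k : Fin d) (c : ZMod (branchNumber μ + 1)) :
    ∃ e : Fin d × Fin (branchNumber μ + 1), e.1 = k ∧ D.edgeColour e = c := by
  set r : ZMod (branchNumber μ + 1) := c - height D.path (D.dist k) - 1 with hr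
  refine ⟨(k, ⟨r.val, r.val_lt⟩), rfl, ?_⟩
  change (height D.path (D.dist k) : ZMod (branchNumber μ + 1)) + (r.val : ZMod _) + 1 = c
  rw [ZMod.natCast_zmod_val, hr]
  ring

/-- Each of the d black polygons has exactly one edge of every colour. -/
lemma ncard_colour (c : ZMod (branchNumber μ + 1)) :
    {e : Fin d × Fin (branchNumber μ + 1) | D.edgeColour e = c}.ncard = d := by
  have h1 : Set.InjOn Prod.fst
      {e : Fin d × Fin (branchNumber μ + 1) | D.edgeColour e = c} :=
    fun e he f hf h => D.colour_injOn_blackFace h (he.trans hf.symm)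
  have h2 : Prod.fst '' {e : Fin d × Fin (branchNumber μ + 1) | D.edgeColour e = c} =
      Set.univ := by
    ext k
    simp only [Set.mem_image, Set.mem_univ, iff_true]
    obtain ⟨e, h1, h2⟩ := D.exists_colour_eq k c
    exact ⟨e, h2, h1⟩
  rw [← h1.ncard_image, h2, Set.ncard_univ, Nat.card_eq_fintype_card, Fintype.card_fin]

/-! ### The white permutation -/

lemma exists_continues (e : Fin d × Fin (branchNumber μ + 1)) :
    ∃ f, D.Continues (D.whiteEnd f) (D.whiteStart e) := by
  obtain ⟨f, hf⟩ := D.exists_whiteEnd_eq (D.isNode_partner (D.isNode_whiteStart e))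
    (D.partner_pos (D.whiteStart_lt_length e).ne)
  exact ⟨f, D.continues_iff.2 (by rw [hf, D.partner_partner])⟩

lemma whiteNext_spec (e : Fin d × Fin (branchNumber μ + 1)) :
    D.whiteEnd (D.whiteNext e) = D.partner (D.whiteStart e) := by
  rw [whiteNext, dif_pos (D.exists_continues e)]
  exact D.partner_injective
    ((D.continues_iff.1 (D.exists_continues e).choose_spec).symm.trans (D.partner_partner _).symm)

lemma whiteNext_eq_iff {e f : Fin d × Fin (branchNumber μ + 1)} :
    D.whiteNext e = f ↔ D.whiteStart e = D.partner (D.whiteEnd f) := by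
  constructor
  · rintro rfl
    rw [D.whiteNext_spec, D.partner_partner]
  · intro h
    apply D.whiteEnd_injective
    rw [D.whiteNext_spec, h, D.partner_partner]

lemma whiteNext_bijective : Function.Bijective D.whiteNext := by
  refine Finite.injective_iff_bijective.1 fun e f h => D.whiteStart_injective ?_
  apply D.partner_injective
  rw [← D.whiteNext_spec, h, D.whiteNext_spec]

/-! ### The rotation around the vertices -/

/-- The edge that follows `e` on its black face. -/
def blackNext (e : Fin d × Fin (branchNumber μ + 1)) : Fin d × Fin (branchNumber μ + 1) :=
  (e.1, e.2 + 1)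

lemma blackNext_val_of_lt {e : Fin d × Fin (branchNumber μ + 1)} (h : (e.2 : ℕ) < branchNumber μ) :
    ((blackNext e).2 : ℕ) = e.2 + 1 :=
  Fin.val_add_one_of_lt (i := e.2) (by rw [Fin.lt_def, Fin.val_last]; exact h)

lemma blackNext_val_of_eq {e : Fin d × Fin (branchNumber μ + 1)} (h : (e.2 : ℕ) = branchNumber μ) :
    ((blackNext e).2 : ℕ) = 0 := by
  have h' : e.2 = Fin.last _ := Fin.ext h
  simp [blackNext, h']

lemma blackNext_bijective :
    Function.Bijective (blackNext (d := d) (μ := μ)) := by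
  refine Finite.injective_iff_bijective.1 fun e f (h : blackNext e = blackNext f) => ?_
  have h1 : (blackNext e).1 = (blackNext f).1 := congrArg Prod.fst h
  have h2 : (blackNext e).2 = (blackNext f).2 := congrArg Prod.snd h
  exact Prod.ext h1 (add_right_cancel h2)

/-- The edge after `e` in the rotation of incoming edges around the head of `e`. -/
noncomputable def rotate (e : Fin d × Fin (branchNumber μ + 1)) :
    Fin d × Fin (branchNumber μ + 1) :=
  (Equiv.ofBijective _ D.whiteNext_bijective).symm (blackNext e)

lemma rotate_eq_iff' {e f : Fin d × Fin (branchNumber μ + 1)} :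
    D.rotate e = f ↔ blackNext e = D.whiteNext f := by
  rw [rotate, Equiv.symm_apply_eq, Equiv.ofBijective_apply]

lemma rotate_eq_iff {e f : Fin d × Fin (branchNumber μ + 1)} :
    D.rotate e = f ↔ D.whiteStart f = D.partner (D.whiteEnd (blackNext e)) := by
  rw [D.rotate_eq_iff', eq_comm, D.whiteNext_eq_iff]

lemma rotate_injective : Function.Injective D.rotate :=
  (Equiv.injective _).comp blackNext_bijective.injective

/-- The tail of the next black edge is the vertex in which `e` ends, seen from the neighbouring
white side. If another up-step of the block follows, this tail is where the path first returns to
the level at which `e` ends; otherwise it is the end of the block itself. -/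
lemma whiteEnd_blackNext_of_lt {e : Fin d × Fin (branchNumber μ + 1)}
    (h : (e.2 : ℕ) < branchNumber μ) :
    D.dist e.1 + e.2 + 1 ≤ D.whiteEnd (blackNext e) ∧
    height D.path (D.whiteEnd (blackNext e)) = height D.path (D.whiteStart e) ∧
      ∀ z, D.dist e.1 + e.2 + 1 < z → z < D.whiteEnd (blackNext e) →
        height D.path (D.whiteStart e) < height D.path z := by
  have hv := blackNext_val_of_lt h
  rw [D.height_whiteStart_of_lt h]
  rcases Nat.lt_or_ge (e.2 + 1 : ℕ) (branchNumber μ) with h' | h'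
  · have hlt : ((blackNext e).2 : ℕ) < branchNumber μ := by omega
    have hS := D.whiteStart_of_lt hlt
    have hu := D.isUp_dist_add e.1 (j := e.2 + 1) h'
    obtain ⟨h1, h2, h3, h4⟩ := hu.matchingDown_spec
    rw [hv, show (blackNext e).1 = e.1 from rfl] at hS
    rw [← hS] at h1 h2 h3 h4
    have h5 := D.height_whiteEnd_of_lt hlt
    rw [D.whiteEnd_of_lt hlt] at h5 ⊢
    have h6 := hu.height_succ
    rw [D.height_dist_add e.1 h] at h6
    refine ⟨by omega, by omega, fun z hz hz' => ?_⟩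
    have := h4 z (by omega) (by omega)
    omega
  · have heq : ((blackNext e).2 : ℕ) = branchNumber μ := by omega
    rw [D.whiteEnd_of_eq heq, show (blackNext e).1 = e.1 from rfl]
    refine ⟨by omega, ?_, by omega⟩
    rw [D.height_dist_add e.1 le_rfl]
    omega

/-- After the internal edge comes the first up-step of the block, whose match descends to the level
of the distinguished vertex. An up-step there would give a second distinguished vertex of equal
height. -/
lemma whiteEnd_blackNext_of_eq {e : Fin d × Fin (branchNumber μ + 1)}
    (h : (e.2 : ℕ) = branchNumber μ) :
    D.dist e.1 < D.whiteEnd (blackNext e) ∧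
    height D.path (D.whiteEnd (blackNext e)) = height D.path (D.dist e.1) ∧
      ¬ IsUp D.path (D.whiteEnd (blackNext e)) := by
  have hv := blackNext_val_of_eq h
  have hb := D.branchNumber_pos
  have hlt : ((blackNext e).2 : ℕ) < branchNumber μ := by omega
  have hS := D.whiteStart_of_lt hlt
  have hu := D.isUp_dist_add e.1 (j := 0) hb
  obtain ⟨h1, h2, h3, h4⟩ := hu.matchingDown_spec
  rw [hv, show (blackNext e).1 = e.1 from rfl] at hS
  rw [← hS] at h1 h2 h3 h4
  have h5 := h2.height_eq
  have h6 := hu.height_succ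
  rw [add_zero] at *
  have h7 : height D.path (D.whiteStart (blackNext e) + 1) = height D.path (D.dist e.1) := by omega
  rw [D.whiteEnd_of_lt hlt]
  refine ⟨by omega, h7, fun hup => ?_⟩
  obtain ⟨l, hl⟩ := D.exists_dist_eq (D.isBDyck.isDistinguished_of_not_isUp hup h2.not_isUp)
  have := D.eq_of_height_dist_eq (k := l) (l := e.1) (by rw [hl, h7])
  rw [this] at hl
  omega

lemma height_whiteEnd_blackNext (e : Fin d × Fin (branchNumber μ + 1)) :
    height D.path (D.whiteEnd (blackNext e)) = height D.path (D.whiteStart e) := by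
  rcases snd_lt_or_eq e with h | h
  · exact (D.whiteEnd_blackNext_of_lt h).2.1
  · rw [(D.whiteEnd_blackNext_of_eq h).2.1, D.height_whiteStart_of_eq h]

/-- The black side of an up-step leads to the point where the matching down-step starts, unless
it meets a distinguished vertex before. -/
lemma whiteEnd_blackNext_eq_iff {e : Fin d × Fin (branchNumber μ + 1)}
    (h : (e.2 : ℕ) < branchNumber μ) :
    D.whiteEnd (blackNext e) = D.whiteStart e ↔
      ¬ IsDistinguished (branchNumber μ) D.path (D.whiteEnd (blackNext e)) := by
  obtain ⟨h1, h2, h3⟩ := D.whiteEnd_blackNext_of_lt h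
  constructor
  · intro heq hd
    rw [heq] at hd
    exact (D.isDown_whiteStart h).not_isUp hd.2
  · intro hd
    have hN := D.isNode_whiteEnd (blackNext e)
    have hnu : ¬ IsUp D.path (D.whiteEnd (blackNext e)) := fun hu => hd ⟨hN.2, hu⟩
    have hS := D.height_whiteStart_of_lt h
    have hL : D.whiteEnd (blackNext e) < D.path.toList.length := by
      refine lt_of_le_of_ne hN.1 fun hL => ?_
      rw [hL, height_length] at h2
      omega
    have h4 := (D.isUp_dist_add e.1 h).height_succ
    rw [D.height_dist_add e.1 h.le] at h4
    conv_rhs => rw [D.whiteStart_of_lt h]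
    refine (matchingDown_eq (by omega) (isDown_of_not_isUp hL hnu) (by omega) fun z hz hz' => ?_).symm
    rcases hz'.eq_or_lt with rfl | hz'
    · omega
    · rcases Nat.eq_or_lt_of_le (show D.dist e.1 + e.2 + 1 ≤ z from hz) with rfl | hz
      · omega
      · have := h3 z hz hz'
        omega

lemma colour_rotate (e : Fin d × Fin (branchNumber μ + 1)) :
    D.edgeColour (D.rotate e) = D.edgeColour e := by
  rw [D.colour_eq, D.colour_eq, D.rotate_eq_iff.1 rfl, D.height_partner,
    D.height_whiteEnd_blackNext]

/-- If a distinguished vertex is met before the match, it is unmarked because the residues are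
disjoint, so the rotation arrives at a block and not at the down-step of `e`. If the match is
reached, only a marked pair can move it. -/
lemma rotate_eq_self_iff_of_lt {e : Fin d × Fin (branchNumber μ + 1)}
    (h : (e.2 : ℕ) < branchNumber μ) :
    D.rotate e = e ↔ D.whiteEnd (blackNext e) = D.whiteStart e ∧
      ∀ i, ¬ D.Marks i (D.whiteStart e) := by
  rw [D.rotate_eq_iff]
  constructor
  · intro heq
    have hA : D.whiteEnd (blackNext e) = D.whiteStart e := by
      by_contra hne
      rw [D.whiteEnd_blackNext_eq_iff h, not_not] at hne
      obtain ⟨k, hk⟩ := D.exists_dist_eq hne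
      have h1 := (D.whiteEnd_blackNext_of_lt h).1
      have hum : ∀ i, ¬ D.Marks i (D.whiteEnd (blackNext e)) := fun i hi =>
        D.residue_left_ne_dist (i := i) (k := k) (by omega) (by rw [hk, D.height_of_marks hi])
      rw [D.partner_of_not_marks hum] at heq
      exact (D.isDown_whiteStart h).not_isUp (heq ▸ hne.2)
    refine ⟨hA, fun i hi => D.partner_ne_of_marks hi ?_⟩
    rw [hA] at heq
    exact heq.symm
  · rintro ⟨h1, h2⟩
    rw [h1, D.partner_of_not_marks h2]

/-- The rotation leads to a later point of the same height. Away from the origin that point is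
unmarked, so the edge moves; for the block at the origin it is the end of the path, which the root
pair glues back to the origin. -/
lemma rotate_eq_self_iff_of_eq {e : Fin d × Fin (branchNumber μ + 1)}
    (h : (e.2 : ℕ) = branchNumber μ) : D.rotate e = e ↔ D.dist e.1 = 0 := by
  rw [D.rotate_eq_iff]
  obtain ⟨h1, h2, h3⟩ := D.whiteEnd_blackNext_of_eq h
  rw [D.whiteStart_of_eq h]
  constructor
  · intro heq
    by_contra hne
    have hum : ∀ i, ¬ D.Marks i (D.whiteEnd (blackNext e)) := fun i hi =>
      D.residue_left_ne_dist (i := i) (k := e.1) hne (by rw [← h2, D.height_of_marks hi])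
    rw [D.partner_of_not_marks hum] at heq
    omega
  · intro h0
    rw [h0, height_zero] at h2
    have hL : D.whiteEnd (blackNext e) = D.path.toList.length := by
      by_contra hL
      have := D.height_pos (x := D.whiteEnd (blackNext e)) (by omega)
        (lt_of_le_of_ne (D.isNode_whiteEnd _).1 hL)
      omega
    rw [hL, D.partner_length, h0]

lemma colour_eq_iff {e : Fin d × Fin (branchNumber μ + 1)} {n : ℕ} :
    D.edgeColour e = (n : ZMod (branchNumber μ + 1)) ↔
      height D.path (D.whiteStart e) % (branchNumber μ + 1) = n % (branchNumber μ + 1) := by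
  rw [D.colour_eq, natCast_eq_natCast_iff_mod]

lemma rotate_eq_self_of_colour_eq_zero {e : Fin d × Fin (branchNumber μ + 1)}
    (h : D.edgeColour e = 0) : D.rotate e = e := by
  rw [← Nat.cast_zero, D.colour_eq_iff, Nat.zero_mod] at h
  rcases snd_lt_or_eq e with he | he
  · rw [D.rotate_eq_self_iff_of_lt he, D.whiteEnd_blackNext_eq_iff he]
    refine ⟨fun hd => ?_, fun i hi => ?_⟩
    · obtain ⟨k, hk⟩ := D.exists_dist_eq hd
      have h1 := D.residue_eq_zero_dist (k := k) (by rw [hk, D.height_whiteEnd_blackNext, h])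
      have h2 := (D.whiteEnd_blackNext_of_lt he).1
      omega
    · have h1 := D.height_of_marks hi
      rw [h1] at h
      rw [D.residue_eq_zero_left h, D.height_root, D.height_whiteStart_of_lt he] at h1
      omega
  · rw [D.height_whiteStart_of_eq he] at h
    rw [D.rotate_eq_self_iff_of_eq he]
    exact D.residue_eq_zero_dist h

/-- On the edges that have the colour of a marked pair, the rotation moves the start of the white side to
its partner. -/
lemma rotate_of_colour_eq_left {i : Fin μ.length} (hi : i ≠ D.root)
    {e : Fin d × Fin (branchNumber μ + 1)}
    (he : D.edgeColour e = (height D.path (D.left i) : ZMod (branchNumber μ + 1))) :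
    D.whiteStart (D.rotate e) = D.partner (D.whiteStart e) := by
  rw [D.colour_eq_iff] at he
  have h0 : height D.path (D.left i) % (branchNumber μ + 1) ≠ 0 :=
    fun h => hi (D.residue_eq_zero_left h)
  have key : ∀ k, height D.path (D.dist k) % (branchNumber μ + 1) ≠
      height D.path (D.left i) % (branchNumber μ + 1) := by
    intro k hk
    by_cases hk0 : D.dist k = 0
    · rw [hk0, height_zero, Nat.zero_mod] at hk
      exact h0 hk.symm
    · exact D.residue_left_ne_dist hk0 hk.symm
  have hlt : (e.2 : ℕ) < branchNumber μ := by
    refine (snd_lt_or_eq e).resolve_right fun h => key e.1 ?_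
    rw [← D.height_whiteStart_of_eq h, he]
  have hA : D.whiteEnd (blackNext e) = D.whiteStart e := by
    rw [D.whiteEnd_blackNext_eq_iff hlt]
    intro hd
    obtain ⟨k, hk⟩ := D.exists_dist_eq hd
    exact key k (by rw [hk, D.height_whiteEnd_blackNext, he])
  rw [D.rotate_eq_iff.1 rfl, hA]

/-- The rotation interchanges the two edges whose white sides start at the points of a marked pair and
fixes the other edges of this colour. -/
lemma exists_transposition_of_left {i : Fin μ.length} (hi : i ≠ D.root) :
    ∃ a a', D.edgeColour a = (height D.path (D.left i) : ZMod (branchNumber μ + 1)) ∧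
      D.whiteStart a = D.left i ∧ D.whiteStart a' = D.right i ∧ D.rotate a = a' ∧
      D.rotate a' = a ∧ ∀ e, D.edgeColour e =
        (height D.path (D.left i) : ZMod (branchNumber μ + 1)) → e ≠ a → e ≠ a' → D.rotate e = e := by
  have hpos := D.height_left_pos hi
  have hl : D.left i < D.path.toList.length := lt_of_le_of_ne (D.isNode_left i).1 fun h => by
    rw [h, height_length] at hpos; omega
  have hr : D.right i < D.path.toList.length := lt_of_le_of_ne (D.isNode_right i).1 fun h => by
    rw [D.height_eq, h, height_length] at hpos; omega
  obtain ⟨a, ha⟩ := D.exists_whiteStart_eq (D.isNode_left i) hl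
  obtain ⟨a', ha'⟩ := D.exists_whiteStart_eq (D.isNode_right i) hr
  have hca : D.edgeColour a = (height D.path (D.left i) : ZMod (branchNumber μ + 1)) := by
    rw [D.colour_eq, ha]
  have hca' : D.edgeColour a' = (height D.path (D.left i) : ZMod (branchNumber μ + 1)) := by
    rw [D.colour_eq, ha', D.height_eq]
  refine ⟨a, a', hca, ha, ha', D.whiteStart_injective ?_, D.whiteStart_injective ?_,
    fun e he h1 h2 => D.whiteStart_injective ?_⟩
  · rw [D.rotate_of_colour_eq_left hi hca, ha, ha', D.partner_left]
  · rw [D.rotate_of_colour_eq_left hi hca', ha, ha', D.partner_right]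
  · rw [D.rotate_of_colour_eq_left hi he]
    refine D.partner_of_not_marks fun j hj => ?_
    have hij : i = j := by
      have he := D.colour_eq_iff.1 he
      rw [D.height_of_marks hj] at he
      exact (D.left_residue_injective he).symm
    subst hij
    rcases hj with hj | hj
    · exact h1 (D.whiteStart_injective (hj.trans ha.symm))
    · exact h2 (D.whiteStart_injective (hj.trans ha'.symm))

/-- No marked point and no other distinguished vertex has this residue, so the only possible
disturbance is that `dist k` is met before the match. -/
lemma rotate_of_colour_eq_dist {k : Fin d} (hk : D.dist k ≠ 0)
    {e : Fin d × Fin (branchNumber μ + 1)} (hne : e ≠ (k, Fin.last _))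
    (he : D.edgeColour e = (height D.path (D.dist k) : ZMod (branchNumber μ + 1))) :
    D.rotate e = e ∨ D.rotate e = (k, Fin.last _) := by
  rw [D.colour_eq_iff] at he
  have hum : ∀ i, ¬ D.Marks i (D.whiteStart e) := fun i hi =>
    D.residue_left_ne_dist (i := i) hk (by rw [← D.height_of_marks hi, he])
  have hlt : (e.2 : ℕ) < branchNumber μ := by
    refine (snd_lt_or_eq e).resolve_right fun h => hne (Prod.ext ?_ (Fin.ext h))
    exact D.dist_residue_injective (by simpa only [D.height_whiteStart_of_eq h] using he)
  by_cases hA : D.whiteEnd (blackNext e) = D.whiteStart e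
  · exact Or.inl ((D.rotate_eq_self_iff_of_lt hlt).2 ⟨hA, hum⟩)
  · right
    rw [D.whiteEnd_blackNext_eq_iff hlt, not_not] at hA
    obtain ⟨l, hl⟩ := D.exists_dist_eq hA
    have hlk : l = k := D.dist_residue_injective (by
      simp only [hl, D.height_whiteEnd_blackNext, he])
    subst hlk
    rw [D.rotate_eq_iff, D.whiteStart_of_eq (e := (l, Fin.last _)) rfl, ← hl,
      D.partner_of_not_marks]
    intro i hi
    exact D.residue_left_ne_dist (i := i) hk (by rw [← D.height_of_marks hi])

lemma exists_transposition {c : ZMod (branchNumber μ + 1)} (hc : c ≠ 0) :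
    ∃ a a', D.edgeColour a = c ∧ a ≠ a' ∧ D.rotate a = a' ∧
      D.rotate a' = a ∧ ∀ e, D.edgeColour e = c → e ≠ a → e ≠ a' → D.rotate e = e := by
  have hcv : ((c.val : ℕ) : ZMod (branchNumber μ + 1)) = c := ZMod.natCast_zmod_val c
  have hlt : c.val < branchNumber μ + 1 := c.val_lt
  have h0 : c.val ≠ 0 := fun h => hc (by rw [← hcv, h, Nat.cast_zero])
  rcases D.exists_residue_eq h0 hlt with ⟨i, hi, hic⟩ | ⟨k, hk, hkc⟩
  · have hc' : (height D.path (D.left i) : ZMod (branchNumber μ + 1)) = c := by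
      rw [← hcv, natCast_eq_natCast_iff_mod, hic, Nat.mod_eq_of_lt hlt]
    obtain ⟨a, a', h1, h2, h3, h4⟩ := D.exists_transposition_of_left hi
    rw [hc'] at h1 h4
    refine ⟨a, a', h1, fun h => ?_, h4⟩
    rw [← h, h2] at h3
    exact D.left_ne_right i i h3
  · have hc' : (height D.path (D.dist k) : ZMod (branchNumber μ + 1)) = c := by
      rw [← hcv, natCast_eq_natCast_iff_mod, hkc, Nat.mod_eq_of_lt hlt]
    set a : Fin d × Fin (branchNumber μ + 1) := (k, Fin.last _) with ha
    have hca : D.edgeColour a = c := by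
      rw [D.colour_eq, D.whiteStart_of_eq (e := a) rfl, ← hc']
    -- The internal edge moves, and every other edge of this colour is fixed or sent to it;
    -- injectivity leaves only a transposition.
    have hne : a ≠ D.rotate a := fun h =>
      hk ((D.rotate_eq_self_iff_of_eq (e := a) rfl).1 h.symm)
    have key : ∀ e, D.edgeColour e = c → e ≠ a → D.rotate e = e ∨ D.rotate e = a :=
      fun e he hea => D.rotate_of_colour_eq_dist hk hea (he.trans hc'.symm)
    have hra : D.rotate (D.rotate a) = a :=
      (key _ ((D.colour_rotate a).trans hca) hne.symm).resolve_left
        fun h => hne (D.rotate_injective h).symm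
    exact ⟨a, D.rotate a, hca, hne, rfl, hra, fun e he h1 h2 =>
      (key e he h1).resolve_right fun h => h2 (D.rotate_injective (h.trans hra.symm))⟩

lemma rotate_rotate (e : Fin d × Fin (branchNumber μ + 1)) : D.rotate (D.rotate e) = e := by
  by_cases hc : D.edgeColour e = 0
  · rw [D.rotate_eq_self_of_colour_eq_zero hc, D.rotate_eq_self_of_colour_eq_zero hc]
  · obtain ⟨a, a', -, -, h1, h2, h3⟩ := D.exists_transposition hc
    by_cases ha : e = a
    · rw [ha, h1, h2]
    · by_cases ha' : e = a'
      · rw [ha', h2, h1]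
      · rw [h3 e rfl ha ha', h3 e rfl ha ha']

/-! ### Vertices -/

/-- The vertex in which an edge ends. -/
noncomputable def edgeHead (e : Fin d × Fin (branchNumber μ + 1)) : D.galaxy.Vertex := D.galaxy.head e

/-- The relation defining vertices is the graph of `rotate`. As `rotate` is an involution, its
classes have at most two edges, so valencies are 2 or 4. -/
lemma head_eq_head_iff {e f : Fin d × Fin (branchNumber μ + 1)} :
    D.edgeHead e = D.edgeHead f ↔ f = e ∨ f = D.rotate e := by
  constructor
  · intro h
    have key : ∀ e f : Fin d × Fin (branchNumber μ + 1),
        Relation.EqvGen (fun e f => blackNext e = D.whiteNext f) e f → f = e ∨ f = D.rotate e := by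
      intro e f h
      induction h with
      | rel e f h => exact Or.inr (D.rotate_eq_iff'.2 h).symm
      | refl e => exact Or.inl rfl
      | symm e f h ih =>
        rcases ih with h | h
        · exact Or.inl h.symm
        · exact Or.inr (by rw [h, D.rotate_rotate])
      | trans e f g h h' h1 h2 =>
        rcases h1 with h1 | h1 <;> rcases h2 with h2 | h2
        · exact Or.inl (h2.trans h1)
        · exact Or.inr (by rw [h2, h1])
        · exact Or.inr (h2.trans h1)
        · exact Or.inl (by rw [h2, h1, D.rotate_rotate])
    exact key e f (Quot.eqvGen_exact h)
  · rintro (rfl | h)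
    · rfl
    · exact Quot.sound (D.rotate_eq_iff'.1 h.symm)

lemma setOf_head_eq (e : Fin d × Fin (branchNumber μ + 1)) :
    {f | D.edgeHead f = D.edgeHead e} = {e, D.rotate e} := by
  ext f
  exact eq_comm.trans D.head_eq_head_iff

lemma valency_edgeHead (e : Fin d × Fin (branchNumber μ + 1)) :
    D.galaxy.valency (D.edgeHead e) = 2 * ({e, D.rotate e} : Set _).ncard := by
  rw [← D.setOf_head_eq]
  rfl

lemma valency_of_rotate_eq {e : Fin d × Fin (branchNumber μ + 1)} (h : D.rotate e = e) :
    D.galaxy.valency (D.edgeHead e) = 2 := by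
  rw [D.valency_edgeHead, h, Set.pair_eq_singleton, Set.ncard_singleton]

lemma valency_of_rotate_ne {e : Fin d × Fin (branchNumber μ + 1)} (h : D.rotate e ≠ e) :
    D.galaxy.valency (D.edgeHead e) = 4 := by
  rw [D.valency_edgeHead, Set.ncard_pair h.symm]

lemma valency_eq_two_iff {e : Fin d × Fin (branchNumber μ + 1)} :
    D.galaxy.valency (D.edgeHead e) = 2 ↔ D.rotate e = e := by
  refine ⟨fun h => ?_, D.valency_of_rotate_eq⟩
  by_contra hne
  rw [D.valency_of_rotate_ne hne] at h
  omega

lemma valency_eq_four_iff {e : Fin d × Fin (branchNumber μ + 1)} :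
    D.galaxy.valency (D.edgeHead e) = 4 ↔ D.rotate e ≠ e := by
  refine ⟨fun h he => ?_, D.valency_of_rotate_ne⟩
  rw [D.valency_of_rotate_eq he] at h
  omega

lemma colourClass_eq_image (c : ZMod (branchNumber μ + 1)) :
    D.galaxy.colourClass c = D.edgeHead '' {e | D.edgeColour e = c} := by
  ext v
  constructor
  · rintro ⟨e, h1, h2⟩
    exact ⟨e, h2, h1⟩
  · rintro ⟨e, h1, h2⟩
    exact ⟨e, h2, h1⟩

lemma ncard_colourClass_zero :
    (D.galaxy.colourClass 0).ncard = d ∧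
      ∀ v ∈ D.galaxy.colourClass 0, D.galaxy.valency v = 2 := by
  constructor
  · rw [D.colourClass_eq_image, Set.InjOn.ncard_image, D.ncard_colour]
    intro e he f hf h
    rcases D.head_eq_head_iff.1 h with h | h
    · exact h.symm
    · rw [h, D.rotate_eq_self_of_colour_eq_zero he]
  · rintro v ⟨e, rfl, he⟩
    exact D.valency_of_rotate_eq (D.rotate_eq_self_of_colour_eq_zero he)

/-- Of the d edges of this colour, exactly the two that are transposed share a head; dropping one of
them makes the head map injective. -/
lemma ncard_colourClass_of_ne_zero {c : ZMod (branchNumber μ + 1)} (hc : c ≠ 0) :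
    (D.galaxy.colourClass c).ncard = d - 1 ∧
      {v | v ∈ D.galaxy.colourClass c ∧ D.galaxy.valency v = 2}.ncard = d - 2 ∧
      {v | v ∈ D.galaxy.colourClass c ∧ D.galaxy.valency v = 4}.ncard = 1 := by
  obtain ⟨a, a', hac, hne, h1, h2, h3⟩ := D.exists_transposition hc
  have hac' : D.edgeColour a' = c := by rw [← h1, D.colour_rotate, hac]
  have hhead : D.edgeHead a' = D.edgeHead a := D.head_eq_head_iff.2 (Or.inr h2.symm)
  have hinj : Set.InjOn D.edgeHead ({e | D.edgeColour e = c} \ {a'}) := by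
    rintro e ⟨he, hea⟩ f ⟨hf, hfa⟩ h
    rcases D.head_eq_head_iff.1 h with h | h
    · exact h.symm
    · by_cases hea' : e = a
      · rw [hea', h1] at h
        exact absurd h hfa
      · rw [h, h3 e he hea' hea]
  have hcard : ({e | D.edgeColour e = c} \ {a'}).ncard = d - 1 := by
    rw [Set.ncard_sdiff_singleton_of_mem (by exact hac'), D.ncard_colour]
  refine ⟨?_, ?_, ?_⟩
  · have : D.galaxy.colourClass c = D.edgeHead '' ({e | D.edgeColour e = c} \ {a'}) := by
      rw [D.colourClass_eq_image]
      ext v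
      constructor
      · rintro ⟨e, he, rfl⟩
        by_cases hea : e = a'
        · exact ⟨a, ⟨hac, hne⟩, by rw [hea, hhead]⟩
        · exact ⟨e, ⟨he, hea⟩, rfl⟩
      · rintro ⟨e, he, rfl⟩
        exact ⟨e, he.1, rfl⟩
    rw [this, hinj.ncard_image, hcard]
  · have : {v | v ∈ D.galaxy.colourClass c ∧ D.galaxy.valency v = 2} =
        D.edgeHead '' (({e | D.edgeColour e = c} \ {a'}) \ {a}) := by
      rw [D.colourClass_eq_image]
      ext v
      constructor
      · rintro ⟨⟨e, he, rfl⟩, hv⟩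
        rw [D.valency_eq_two_iff] at hv
        refine ⟨e, ⟨⟨he, ?_⟩, ?_⟩, rfl⟩
        · rintro rfl
          exact hne (h2.symm.trans hv)
        · rintro rfl
          exact hne (hv.symm.trans h1)
      · rintro ⟨e, ⟨⟨he, h⟩, h'⟩, rfl⟩
        exact ⟨⟨e, he, rfl⟩, D.valency_of_rotate_eq (h3 e he h' h)⟩
    rw [this, (hinj.mono Set.sdiff_subset).ncard_image,
      Set.ncard_sdiff_singleton_of_mem (by exact ⟨hac, hne⟩), hcard]
    omega
  · have : {v | v ∈ D.galaxy.colourClass c ∧ D.galaxy.valency v = 4} = {D.edgeHead a} := by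
      rw [D.colourClass_eq_image]
      ext v
      constructor
      · rintro ⟨⟨e, he, rfl⟩, hv⟩
        rw [D.valency_eq_four_iff] at hv
        by_cases hea : e = a
        · rw [hea]; rfl
        · by_cases hea' : e = a'
          · rw [hea']; exact hhead
          · exact absurd (h3 e he hea hea') hv
      · rintro rfl
        exact ⟨⟨a, hac, rfl⟩, D.valency_of_rotate_ne fun h => hne (h.symm.trans h1)⟩
    rw [this, Set.ncard_singleton]

/-- The colour is constant on vertices, so the colour classes can be summed: d for colour 0 and d -
1 for each of the b others. -/
lemma card_vertex : Nat.card D.galaxy.Vertex = d + branchNumber μ * (d - 1) := by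
  classical
  have : Finite D.galaxy.Edge := inferInstanceAs (Finite (Fin d × Fin (branchNumber μ + 1)))
  have hfin : Finite D.galaxy.Vertex := Quot.finite _
  let f : D.galaxy.Vertex → ZMod (branchNumber μ + 1) := Quot.lift D.galaxy.colour
    fun e e' h => ((D.colour_rotate e).symm.trans (congrArg D.edgeColour (D.rotate_eq_iff'.2 h)) :)
  have hf : ∀ c, Nat.card {v // f v = c} = (D.galaxy.colourClass c).ncard := by
    intro c
    change Nat.card ({v | f v = c} : Set D.galaxy.Vertex) = _
    rw [Nat.card_coe_set_eq]
    congr 1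
    ext v
    obtain ⟨e, rfl⟩ := Quot.exists_rep v
    constructor
    · intro h
      exact ⟨e, rfl, h⟩
    · rintro ⟨e', h1, h2⟩
      rw [← h2]
      exact congrArg f h1.symm
  rw [Nat.card_congr (Equiv.sigmaFiberEquiv f).symm, Nat.card_sigma]
  simp only [hf]
  rw [← Finset.add_sum_erase _ _ (Finset.mem_univ (0 : ZMod (branchNumber μ + 1))),
    D.ncard_colourClass_zero.1, Finset.sum_congr rfl fun c hc =>
      (D.ncard_colourClass_of_ne_zero (Finset.ne_of_mem_erase hc)).1,
    Finset.sum_const, Finset.card_erase_of_mem (Finset.mem_univ _), Finset.card_univ, ZMod.card,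
    smul_eq_mul, Nat.add_sub_cancel]

/-! ### Essential intervals -/

/-- The step at `s` lies between the points of the `i`-th marked pair. -/
def Between (i : Fin μ.length) (s : ℕ) : Prop := D.left i ≤ s ∧ s < D.right i

/-- A step lies in the essential interval of the innermost marked pair around it. -/
lemma inEssential_iff {i : Fin μ.length} {s : ℕ} :
    D.InEssential i s ↔ D.Between i s ∧ ∀ j, D.Between j s → D.left j ≤ D.left i := by
  constructor
  · rintro ⟨h, hj⟩
    refine ⟨h, fun j hjs => ?_⟩
    by_contra hlt
    have hne : j ≠ i := by rintro rfl; exact hlt le_rfl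
    refine hj j hne (by omega) ?_ hjs
    by_contra hr
    have h1 := h.2
    have h2 := hjs.1
    exact D.noncrossing i j ⟨by omega, by omega, by omega⟩
  · rintro ⟨h, hj⟩
    exact ⟨h, fun j hne hl _ hjs => hne (D.left_injective (le_antisymm (hj j hjs) hl))⟩

lemma inEssential_unique {i j : Fin μ.length} {s : ℕ} (hi : D.InEssential i s)
    (hj : D.InEssential j s) : i = j := by
  rw [D.inEssential_iff] at hi hj
  exact D.left_injective (le_antisymm (hj.2 i hi.1) (hi.2 j hj.1))

lemma exists_inEssential {s : ℕ} (hs : s < D.path.toList.length) : ∃ i, D.InEssential i s := by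
  classical
  obtain ⟨i, hi, hmax⟩ := Finset.exists_max_image (Finset.univ.filter fun i => D.Between i s) D.left
    ⟨D.root, by
      rw [Finset.mem_filter]
      exact ⟨Finset.mem_univ _, by rw [D.left_root]; exact Nat.zero_le s,
        by rw [D.right_root_eq]; exact hs⟩⟩
  rw [Finset.mem_filter] at hi
  exact ⟨i, D.inEssential_iff.2 ⟨hi.2, fun j hj =>
    hmax j (Finset.mem_filter.2 ⟨Finset.mem_univ _, hj⟩)⟩⟩

lemma inEssential_congr {s t : ℕ} (h : ∀ j, D.Between j s ↔ D.Between j t) (i : Fin μ.length) :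
    D.InEssential i s ↔ D.InEssential i t := by
  simp only [D.inEssential_iff, h]

lemma inEssential_left (i : Fin μ.length) : D.InEssential i (D.left i) :=
  D.inEssential_iff.2 ⟨⟨le_rfl, D.left_lt_right i⟩, fun _ h => h.1⟩

lemma inEssential_whiteIndex (e : Fin d × Fin (branchNumber μ + 1)) :
    D.InEssential (D.whiteIndex e) (D.whiteStart e) := by
  have h := D.exists_inEssential (D.whiteStart_lt_length e)
  rw [whiteIndex, dif_pos h]
  exact h.choose_spec

lemma whiteIndex_eq_iff {e : Fin d × Fin (branchNumber μ + 1)} {i : Fin μ.length} :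
    D.whiteIndex e = i ↔ D.InEssential i (D.whiteStart e) :=
  ⟨fun h => h ▸ D.inEssential_whiteIndex e,
    fun h => D.inEssential_unique (D.inEssential_whiteIndex e) h⟩

lemma between_whiteStart_iff {e : Fin d × Fin (branchNumber μ + 1)} {j : Fin μ.length} :
    D.Between j (D.whiteStart e) ↔ D.left j < D.whiteEnd e ∧ D.whiteEnd e ≤ D.right j := by
  have h := D.whiteStart_lt_whiteEnd e
  constructor
  · rintro ⟨h1, h2⟩
    exact ⟨by omega, D.whiteEnd_le_of_lt (D.isNode_right j) h2⟩
  · rintro ⟨h1, h2⟩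
    refine ⟨?_, by omega⟩
    by_contra hn
    have := D.whiteEnd_le_of_lt (e := e) (D.isNode_left j) (by omega)
    omega

lemma right_lt_right_of_left_lt {i j : Fin μ.length} (h1 : D.left i < D.left j)
    (h2 : D.left j < D.right i) : D.right j < D.right i := by
  refine lt_of_le_of_ne (not_lt.1 fun h => D.noncrossing i j ⟨h1, h2, h⟩) fun h => ?_
  rw [D.right_injective h] at h1
  omega

/-- The same marked pairs surround two consecutive edges of a white polygon. -/
lemma between_iff_of_partner {p : ℕ} (j : Fin μ.length) :
    (D.left j < p ∧ p ≤ D.right j) ↔ D.Between j (D.partner p) := by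
  refine D.partner_cases (P := fun p q => (D.left j < p ∧ p ≤ D.right j) ↔ D.Between j q)
    (fun m => ?_) (fun m => ?_) (fun p hp => ?_) p
  · have h1 := D.left_lt_right m
    have h2 := D.left_ne_right m j
    have h3 := D.left_ne_right j m
    constructor
    · rintro ⟨h4, h5⟩
      exact ⟨by omega, D.right_lt_right_of_left_lt h4 (by omega)⟩
    · rintro ⟨h4, h5⟩
      refine ⟨?_, by omega⟩
      by_contra hn
      rcases (not_lt.1 hn).eq_or_lt with h | h
      · rw [D.left_injective h] at h5
        omega
      · have := D.right_lt_right_of_left_lt h (by omega)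
        omega
  · have h1 := D.left_lt_right m
    have h2 := D.left_ne_right m j
    have h3 := D.left_ne_right j m
    constructor
    · rintro ⟨h4, h5⟩
      refine ⟨?_, by omega⟩
      by_contra hn
      have := D.right_lt_right_of_left_lt (i := m) (j := j) (by omega) (by omega)
      omega
    · rintro ⟨h4, h5⟩
      refine ⟨by omega, ?_⟩
      rcases h4.eq_or_lt with h | h
      · rw [D.left_injective h]
      · exact (D.right_lt_right_of_left_lt h h5).le
  · have h1 : p ≠ D.left j := fun h => hp j (Or.inl h)
    have h2 : p ≠ D.right j := fun h => hp j (Or.inr h)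
    constructor
    · rintro ⟨h4, h5⟩
      exact ⟨h4.le, by omega⟩
    · rintro ⟨h4, h5⟩
      exact ⟨by omega, h5.le⟩

lemma whiteIndex_whiteNext (e : Fin d × Fin (branchNumber μ + 1)) :
    D.whiteIndex (D.whiteNext e) = D.whiteIndex e := by
  rw [D.whiteIndex_eq_iff, D.inEssential_congr (t := D.whiteStart e)]
  · exact D.inEssential_whiteIndex e
  · intro j
    rw [D.between_whiteStart_iff, D.between_iff_of_partner, D.whiteNext_eq_iff.1 rfl]

/-! ### White faces -/

/-- The white face on the right of an edge. -/
noncomputable def edgeWhiteFace (e : Fin d × Fin (branchNumber μ + 1)) : D.galaxy.WhiteFace :=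
  D.galaxy.whiteFace e

lemma edgeWhiteFace_whiteNext (e : Fin d × Fin (branchNumber μ + 1)) :
    D.edgeWhiteFace (D.whiteNext e) = D.edgeWhiteFace e :=
  (Quot.sound (r := fun e e' : D.galaxy.Edge => D.galaxy.white e = e') rfl).symm

/-- Walking around the polygon against `whiteNext` moves to the right along the path, jumping over
nested pairs, until the right point of the innermost surrounding pair is reached. So every edge with
that label lies on the face of one fixed edge. -/
lemma edgeWhiteFace_eq_of_whiteEnd {e f : Fin d × Fin (branchNumber μ + 1)}
    (hf : D.whiteEnd f = D.right (D.whiteIndex e)) : D.edgeWhiteFace e = D.edgeWhiteFace f := by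
  induction h : D.path.toList.length - D.whiteStart e using Nat.strong_induction_on generalizing e with
  | _ n ih =>
    by_cases hef : e = f
    · rw [hef]
    obtain ⟨e', he'⟩ := D.whiteNext_bijective.surjective e
    have hS := D.whiteNext_eq_iff.1 he'
    have hi : D.whiteIndex e' = D.whiteIndex e := by rw [← he', D.whiteIndex_whiteNext]
    have hF : D.edgeWhiteFace e' = D.edgeWhiteFace e := by rw [← he', D.edgeWhiteFace_whiteNext]
    have h1 := D.whiteStart_lt_whiteEnd e
    have hss : D.whiteStart e < D.whiteStart e' := by
      rw [hS]
      obtain ⟨hb, hmax⟩ := D.inEssential_iff.1 (D.inEssential_whiteIndex e)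
      rcases D.continues_iff.2 (rfl : D.partner (D.whiteEnd e) = _) with
        ⟨m, hm, hm'⟩ | ⟨m, hm, hm'⟩ | ⟨hm, -⟩
      · have := D.left_lt_right m
        omega
      -- A right point reached here closes a pair around `e`. As the index is innermost, this is the
      -- pair of the index itself, and then `e` is already `f`.
      · exfalso
        have hne : m ≠ D.whiteIndex e := fun h =>
          hef (D.whiteEnd_injective (by rw [hf, hm, h]))
        have hbm : D.Between m (D.whiteStart e) := D.between_whiteStart_iff.2
          ⟨by rw [hm]; exact D.left_lt_right m, hm.le⟩
        have h2 := hmax m hbm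
        rcases h2.eq_or_lt with h2 | h2
        · exact hne (D.left_injective h2)
        · have h3 := D.right_lt_right_of_left_lt h2 (lt_of_le_of_lt hb.1 hbm.2)
          have := (D.between_whiteStart_iff.1 hb).2
          omega
      · omega
    have := D.whiteStart_lt_length e'
    rw [← hF]
    exact ih _ (by omega) (by rw [hi, hf]) rfl

lemma edgeWhiteFace_eq_iff {e f : Fin d × Fin (branchNumber μ + 1)} :
    D.edgeWhiteFace e = D.edgeWhiteFace f ↔ D.whiteIndex e = D.whiteIndex f := by
  constructor
  · intro h
    exact congrArg (Quot.lift D.whiteIndex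
      fun (e e' : Fin d × Fin (branchNumber μ + 1)) (h : D.whiteNext e = e') => by
        rw [← h, D.whiteIndex_whiteNext]) h
  · intro h
    obtain ⟨g, hg⟩ := D.exists_whiteEnd_eq (D.isNode_right (D.whiteIndex e))
      (lt_of_le_of_lt (Nat.zero_le _) (D.left_lt_right _))
    rw [D.edgeWhiteFace_eq_of_whiteEnd hg, 
      D.edgeWhiteFace_eq_of_whiteEnd (e := f) (f := g) (h ▸ hg)]

lemma whiteIndex_surjective : Function.Surjective D.whiteIndex := by
  intro i
  obtain ⟨e, he⟩ := D.exists_whiteStart_eq (D.isNode_left i)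
    (lt_of_lt_of_le (D.left_lt_right i) (D.isNode_right i).1)
  exact ⟨e, D.whiteIndex_eq_iff.2 (he ▸ D.inEssential_left i)⟩

lemma card_eq_of_label {α β F : Type*} {face : α → F} {label : α → β}
    (hface : Function.Surjective face) (hlabel : Function.Surjective label)
    (h : ∀ x y, face x = face y ↔ label x = label y) : Nat.card F = Nat.card β := by
  refine Nat.card_congr (Equiv.ofBijective
    (fun F => label (Function.surjInv hface F)) ⟨fun F F' hF => ?_, fun y => ?_⟩)
  · rw [← Function.surjInv_eq hface F, ← Function.surjInv_eq hface F', h]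
    exact hF
  · obtain ⟨x, rfl⟩ := hlabel y
    exact ⟨face x, (h _ _).1 (Function.surjInv_eq hface _)⟩

lemma card_whiteFace : Nat.card D.galaxy.WhiteFace = μ.length := by
  rw [card_eq_of_label (face := D.edgeWhiteFace) (label := D.whiteIndex) Quot.mk_surjective
    D.whiteIndex_surjective fun _ _ => D.edgeWhiteFace_eq_iff, Nat.card_eq_fintype_card,
    Fintype.card_fin]

/-! ### Perimeters -/

lemma between_dist_add_iff (k : Fin d) {j : ℕ} (hj : j < branchNumber μ) (i : Fin μ.length) :
    D.Between i (D.dist k + j) ↔ D.Between i (D.dist k) := by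
  have key : ∀ p, D.IsNode p → D.dist k < p → D.dist k + branchNumber μ ≤ p := by
    intro p hp h
    have h1 := D.whiteEnd_le_of_lt (e := (k, Fin.last _)) hp (by rwa [D.whiteStart_of_eq rfl])
    rwa [D.whiteEnd_of_eq rfl] at h1
  have h1 := key _ (D.isNode_left i)
  have h2 := key _ (D.isNode_right i)
  unfold Between
  omega

open Classical in
/-- The distinguished vertices in the essential interval of a marked pair. -/
noncomputable def essentialBlocks (i : Fin μ.length) : Finset (Fin d) :=
  Finset.univ.filter fun k => D.InEssential i (D.dist k)

lemma mem_essentialBlocks {i : Fin μ.length} {k : Fin d} :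
    k ∈ D.essentialBlocks i ↔ D.InEssential i (D.dist k) := by
  simp [essentialBlocks]

/-- No marked point lies inside a block, so the up-steps of an essential interval form whole blocks
and the degree counts them. -/
lemma card_essentialBlocks (i : Fin μ.length) : (D.essentialBlocks i).card = μ.blocksFun i := by
  classical
  have hb := D.branchNumber_pos
  have h1 : {s | D.InEssential i s ∧ IsUp D.path s} =
      ((D.essentialBlocks i ×ˢ Finset.range (branchNumber μ)).image
        fun q => D.dist q.1 + q.2 : Finset ℕ) := by
    ext s
    rw [Finset.coe_image]
    constructor
    · rintro ⟨hs, hu⟩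
      obtain ⟨x, j, hx, hj, rfl⟩ := D.isBDyck.exists_block hu
      obtain ⟨k, rfl⟩ := D.exists_dist_eq hx
      refine ⟨(k, j), ?_, rfl⟩
      rw [Finset.mem_coe, Finset.mem_product, D.mem_essentialBlocks, Finset.mem_range]
      exact ⟨(D.inEssential_congr (D.between_dist_add_iff k hj) i).1 hs, hj⟩
    · rintro ⟨⟨k, j⟩, hq, rfl⟩
      rw [Finset.mem_coe, Finset.mem_product, D.mem_essentialBlocks, Finset.mem_range] at hq
      exact ⟨(D.inEssential_congr (D.between_dist_add_iff k hq.2) i).2 hq.1,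
        D.isUp_dist_add k hq.2⟩
  have h2 := D.degree_eq i
  rw [MarkedDyckPath.degree, h1, Set.ncard_coe_finset, Finset.card_image_of_injOn,
    Finset.card_product, Finset.card_range, Nat.cast_mul, mul_div_assoc, div_self, mul_one] at h2
  · exact_mod_cast h2
  · exact_mod_cast hb.ne'
  · rintro ⟨k, j⟩ hq ⟨k', j'⟩ hq' h
    rw [Finset.mem_coe, Finset.mem_product, Finset.mem_range] at hq hq'
    obtain ⟨h3, rfl⟩ := D.isBDyck.block_unique (D.isDistinguished_dist k)
      (D.isDistinguished_dist k') hq.2 hq'.2 h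
    rw [D.dist_injective h3]

/-- Heights cancel around a closed polygon: a down-step contributes -1 and a block +b. Adding 1 per
edge, the number of edges is b + 1 times the number of blocks. -/
lemma ncard_whiteIndex (i : Fin μ.length) :
    {e | D.whiteIndex e = i}.ncard = μ.blocksFun i * (branchNumber μ + 1) := by
  classical
  set C : Finset (Fin d × Fin (branchNumber μ + 1)) :=
    Finset.univ.filter fun e => D.whiteIndex e = i with hC
  have hmem : ∀ e, e ∈ C ↔ D.whiteIndex e = i := fun e => by simp [hC]
  have hset : {e | D.whiteIndex e = i} = (C : Set (Fin d × Fin (branchNumber μ + 1))) := by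
    ext e
    rw [Finset.mem_coe, hmem]
    rfl
  have hblocks : (C.filter fun e => (e.2 : ℕ) = branchNumber μ).card = μ.blocksFun i := by
    rw [← D.card_essentialBlocks]
    refine Finset.card_bij (fun e _ => e.1) (fun e he => ?_) (fun e he f hf h => ?_) fun k hk => ?_
    · rw [Finset.mem_filter, hmem, D.whiteIndex_eq_iff] at he
      rw [D.mem_essentialBlocks, ← D.whiteStart_of_eq he.2]
      exact he.1
    · exact Prod.ext h (Fin.ext ((Finset.mem_filter.1 he).2.trans (Finset.mem_filter.1 hf).2.symm))
    · refine ⟨(k, Fin.last _), ?_, rfl⟩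
      rw [Finset.mem_filter, hmem, D.whiteIndex_eq_iff, D.whiteStart_of_eq rfl]
      exact ⟨D.mem_essentialBlocks.1 hk, rfl⟩
  -- The white permutation preserves `C` and matches each start with an end of equal height.
  have hsum : ∑ e ∈ C, height D.path (D.whiteStart e) = ∑ e ∈ C, height D.path (D.whiteEnd e) := by
    refine Finset.sum_bij (fun e _ => D.whiteNext e) (fun e he => ?_)
      (fun e _ f _ h => D.whiteNext_bijective.injective h) (fun f hf => ?_) fun e _ => ?_
    · rw [hmem, D.whiteIndex_whiteNext]
      exact (hmem e).1 he
    · obtain ⟨e, rfl⟩ := D.whiteNext_bijective.surjective f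
      rw [hmem, D.whiteIndex_whiteNext] at hf
      exact ⟨e, (hmem e).2 hf, rfl⟩
    · rw [D.whiteNext_spec, D.height_partner]
  have hstep : ∀ e ∈ C, height D.path (D.whiteEnd e) + 1 =
      height D.path (D.whiteStart e) +
        (if (e.2 : ℕ) = branchNumber μ then branchNumber μ + 1 else 0) := by
    intro e _
    rcases snd_lt_or_eq e with h | h
    · rw [if_neg h.ne, D.height_whiteEnd_of_lt h]
    · rw [if_pos h, D.height_whiteEnd_of_eq h]
      omega
  have htot := Finset.sum_congr (rfl : C = C) hstep
  rw [Finset.sum_add_distrib, Finset.sum_add_distrib, hsum, add_right_inj, ← Finset.sum_filter,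
    Finset.sum_const, Finset.sum_const, hblocks, smul_eq_mul, smul_eq_mul, mul_one] at htot
  rw [hset, Set.ncard_coe_finset, htot]

/-! ### Black faces -/

/-- The black face on the left of an edge. -/
noncomputable def edgeBlackFace (e : Fin d × Fin (branchNumber μ + 1)) : D.galaxy.BlackFace :=
  D.galaxy.blackFace e

lemma edgeBlackFace_blackNext (e : Fin d × Fin (branchNumber μ + 1)) :
    D.edgeBlackFace (blackNext e) = D.edgeBlackFace e :=
  (Quot.sound (r := fun e e' : D.galaxy.Edge => D.galaxy.black e = e') rfl).symm

lemma edgeBlackFace_eq_zero (k : Fin d) (j : Fin (branchNumber μ + 1)) :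
    D.edgeBlackFace (k, j) = D.edgeBlackFace (k, 0) := by
  induction j using Fin.induction with
  | zero => rfl
  | succ j ih =>
    rw [← ih, ← D.edgeBlackFace_blackNext (k, j.castSucc), blackNext, Fin.coeSucc_eq_succ]

lemma edgeBlackFace_eq_iff {e f : Fin d × Fin (branchNumber μ + 1)} :
    D.edgeBlackFace e = D.edgeBlackFace f ↔ e.1 = f.1 := by
  constructor
  · intro h
    exact congrArg (Quot.lift Prod.fst
      fun (e e' : Fin d × Fin (branchNumber μ + 1)) (h : blackNext e = e') => by rw [← h]; rfl) h
  · intro h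
    obtain ⟨k, j⟩ := e
    obtain ⟨k', j'⟩ := f
    obtain rfl : k = k' := h
    rw [D.edgeBlackFace_eq_zero k j, D.edgeBlackFace_eq_zero k j']

lemma card_blackFace : Nat.card D.galaxy.BlackFace = d := by
  rw [card_eq_of_label (face := D.edgeBlackFace) (label := Prod.fst) Quot.mk_surjective
    (fun k => ⟨(k, 0), rfl⟩) fun _ _ => D.edgeBlackFace_eq_iff, Nat.card_eq_fintype_card,
    Fintype.card_fin]

lemma ncard_fst (k : Fin d) :
    {e : Fin d × Fin (branchNumber μ + 1) | e.1 = k}.ncard = branchNumber μ + 1 := by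
  have : {e : Fin d × Fin (branchNumber μ + 1) | e.1 = k} =
      (fun j => (k, j)) '' (Set.univ : Set (Fin (branchNumber μ + 1))) := by
    ext ⟨l, j⟩
    constructor
    · rintro rfl
      exact ⟨j, Set.mem_univ _, rfl⟩
    · rintro ⟨j', -, h⟩
      exact (congrArg Prod.fst h).symm
  rw [this, Set.ncard_image_of_injective _ (Prod.mk_right_injective k), Set.ncard_univ,
    Nat.card_eq_fintype_card, Fintype.card_fin]

/-! ### Connectedness -/

/-- Two edges can be joined by walking along faces. -/
def Joined : Fin d × Fin (branchNumber μ + 1) → Fin d × Fin (branchNumber μ + 1) → Prop :=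
  Relation.EqvGen fun e f => D.whiteNext e = f ∨ blackNext e = f

lemma joined_equivalence : Equivalence D.Joined := Relation.EqvGen.is_equivalence _

lemma joined_whiteNext (e : Fin d × Fin (branchNumber μ + 1)) : D.Joined e (D.whiteNext e) :=
  Relation.EqvGen.rel _ _ (Or.inl rfl)

lemma joined_blackNext (e : Fin d × Fin (branchNumber μ + 1)) : D.Joined e (blackNext e) :=
  Relation.EqvGen.rel _ _ (Or.inr rfl)

lemma joined_rotate (e : Fin d × Fin (branchNumber μ + 1)) : D.Joined e (D.rotate e) := by
  refine D.joined_equivalence.trans (D.joined_blackNext e) ?_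
  rw [D.rotate_eq_iff'.1 rfl]
  exact D.joined_equivalence.symm (D.joined_whiteNext _)

/-- Induction along the path: at an unmarked node, consecutive pieces belong to consecutive edges of
a white face. At a marked node, the rotation supplies the link through the other point of the pair.
-/
lemma joined_of_whiteStart_eq_zero {e₀ : Fin d × Fin (branchNumber μ + 1)}
    (h₀ : D.whiteStart e₀ = 0) (e : Fin d × Fin (branchNumber μ + 1)) : D.Joined e₀ e := by
  induction h : D.whiteStart e using Nat.strong_induction_on generalizing e with
  | _ s ih =>
    rcases Nat.eq_zero_or_pos s with rfl | hs
    · rw [D.whiteStart_injective (h₀.trans h.symm)]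
      exact D.joined_equivalence.refl e
    obtain ⟨f, hf⟩ := D.exists_whiteEnd_eq (h ▸ D.isNode_whiteStart e) hs
    have hlt := D.whiteStart_lt_whiteEnd f
    have hef := ih _ (by omega) f rfl
    by_cases hm : ∃ i, D.Marks i s
    · obtain ⟨i, hi⟩ := hm
      have hL := D.whiteStart_lt_length e
      have hroot : i ≠ D.root := by
        rintro rfl
        have h1 := D.left_root
        have h2 := D.right_root_eq
        rcases hi with hi | hi <;> omega
      obtain ⟨a, a', -, ha, ha', haa', -⟩ := D.exists_transposition_of_left hroot
      have hj := haa' ▸ D.joined_rotate a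
      rcases hi with hi | hi
      · rw [D.whiteStart_injective (h.trans (hi.trans ha.symm))]
        have : D.whiteNext a' = f := by
          rw [D.whiteNext_eq_iff, hf, hi, D.partner_left, ha']
        refine D.joined_equivalence.trans hef (D.joined_equivalence.trans ?_
          (D.joined_equivalence.symm hj))
        rw [← this]
        exact D.joined_equivalence.symm (D.joined_whiteNext a')
      · rw [D.whiteStart_injective (h.trans (hi.trans ha'.symm))]
        have h1 := D.left_lt_right i
        exact D.joined_equivalence.trans (ih _ (by omega) a rfl) hj
    · push Not at hm
      have : D.whiteNext e = f := by
        rw [D.whiteNext_eq_iff, hf, h, D.partner_of_not_marks hm]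
      refine D.joined_equivalence.trans hef ?_
      rw [← this]
      exact D.joined_equivalence.symm (D.joined_whiteNext e)

lemma joined (e f : Fin d × Fin (branchNumber μ + 1)) : D.Joined e f := by
  obtain ⟨e₀, h₀⟩ := D.exists_whiteStart_eq (p := 0) ⟨Nat.zero_le _, D.isDistinguished_zero.1⟩
    D.length_pos
  exact D.joined_equivalence.trans
    (D.joined_equivalence.symm (D.joined_of_whiteStart_eq_zero h₀ e))
    (D.joined_of_whiteStart_eq_zero h₀ f)

/-! ### Colours along the faces and the galaxy axioms. -/

lemma edgeColour_whiteNext (e : Fin d × Fin (branchNumber μ + 1)) :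
    D.edgeColour (D.whiteNext e) = D.edgeColour e + 1 := by
  rw [D.colour_eq_whiteEnd, D.whiteNext_spec, D.height_partner, D.colour_eq]

lemma edgeColour_blackNext (e : Fin d × Fin (branchNumber μ + 1)) :
    D.edgeColour (blackNext e) = D.edgeColour e + 1 := by
  change (height D.path (D.dist e.1) : ZMod (branchNumber μ + 1)) +
    (((blackNext e).2 : ℕ) : ZMod _) + 1 =
      (height D.path (D.dist e.1) : ZMod (branchNumber μ + 1)) + ((e.2 : ℕ) : ZMod _) + 1 + 1
  rcases snd_lt_or_eq e with h | h
  · rw [blackNext_val_of_lt h]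
    push_cast
    ring
  · rw [blackNext_val_of_eq h, h, Nat.cast_zero, add_zero,
      add_assoc _ (branchNumber μ : ZMod (branchNumber μ + 1)) 1, natCast_branchNumber_add_one,
      add_zero]

theorem isHurwitzGalaxy : IsHurwitzGalaxy 0 μ (Composition.ones d) D.galaxy where
  b_eq := by rw [Composition.ones_length, D.branchNumber_add_two]; omega
  finite := inferInstanceAs (Finite (Fin d × Fin (branchNumber μ + 1)))
  nonempty := ⟨(⟨0, D.d_pos⟩, (0 : Fin (branchNumber μ + 1)))⟩
  white_bijective := D.whiteNext_bijective
  black_bijective := blackNext_bijective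
  connected := D.joined
  euler := by
    rw [D.card_vertex, D.card_whiteFace, D.card_blackFace]
    have h : Nat.card D.galaxy.Edge = d * (branchNumber μ + 1) := by
      change Nat.card (Fin d × Fin (branchNumber μ + 1)) = _
      simp
    have h1 := D.branchNumber_add_two
    obtain ⟨n, hn⟩ : ∃ n, d = n + 1 := ⟨d - 1, by have := D.d_pos; omega⟩
    have h2 : d - 1 = n := by omega
    rw [h, h2]
    -- With this form of the edge number, Euler's relation reduces to b + 2 = ℓ + d.
    have h3 : d * (branchNumber μ + 1) = branchNumber μ * n + branchNumber μ + d := by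
      conv_lhs => rw [mul_comm]
      have : branchNumber μ * d = branchNumber μ * (n + 1) := congrArg _ hn
      rw [add_mul, this]
      ring
    omega
  whiteLabel_iff e e' := D.edgeWhiteFace_eq_iff.symm
  blackLabel_iff e e' := by
    refine Iff.trans ?_ D.edgeBlackFace_eq_iff.symm
    exact (Fin.cast_injective (Composition.ones_length d).symm).eq_iff
  white_perimeter := D.ncard_whiteIndex
  black_perimeter i := by
    have h1 := ncard_fst (μ := μ) (Fin.cast (Composition.ones_length d) i)
    rw [Composition.ones_blocksFun, one_mul]
    refine Eq.trans (congrArg Set.ncard (Set.ext fun e => ?_)) h1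
    exact ⟨fun h => Fin.ext (congrArg Fin.val (show D.galaxy.blackLabel e = i from h) :),
      fun h => Fin.ext (congrArg Fin.val (show e.1 = Fin.cast _ i from h) :)⟩
  colour_white := D.edgeColour_whiteNext
  colour_black := D.edgeColour_blackNext
  colour_ne_zero _ hc := D.ncard_colourClass_of_ne_zero hc
  colour_zero := D.ncard_colourClass_zero

/-! ### Bubbles -/

/-- The edges of one black face have different colours, hence different heads, so its 4-valent
vertices correspond to its edges that `rotate` moves. -/
lemma isBlackBubble_iff (k : Fin d) :
    IsBlackBubble D.galaxy (D.edgeBlackFace (k, 0)) ↔ ∃! e, e.1 = k ∧ D.rotate e ≠ e := by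
  have hset : {v | D.galaxy.valency v = 4 ∧ ∃ e, D.galaxy.blackFace e = D.edgeBlackFace (k, 0) ∧
      D.galaxy.head e = v} = D.edgeHead '' {e | e.1 = k ∧ D.rotate e ≠ e} := by
    ext v
    constructor
    · rintro ⟨hv, e, he, rfl⟩
      exact ⟨e, ⟨D.edgeBlackFace_eq_iff.1 he, D.valency_eq_four_iff.1 hv⟩, rfl⟩
    · rintro ⟨e, ⟨h1, h2⟩, rfl⟩
      exact ⟨D.valency_of_rotate_ne h2, e, D.edgeBlackFace_eq_iff.2 h1, rfl⟩
  have hinj : Set.InjOn D.edgeHead {e | e.1 = k ∧ D.rotate e ≠ e} := by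
    rintro e ⟨he, -⟩ f ⟨hf, -⟩ h
    rcases D.head_eq_head_iff.1 h with h | h
    · exact h.symm
    · exact D.colour_injOn_blackFace (he.trans hf.symm) (by rw [h, D.colour_rotate])
  rw [IsBlackBubble, hset, hinj.ncard_image, Set.ncard_eq_one]
  constructor
  · rintro ⟨e, he⟩
    have hmem : ∀ f, (f.1 = k ∧ D.rotate f ≠ f) ↔ f = e := fun f => Set.ext_iff.1 he f
    exact ⟨e, (hmem e).2 rfl, fun f hf => (hmem f).1 hf⟩
  · rintro ⟨e, he, huniq⟩
    exact ⟨e, Set.ext fun f => ⟨fun hf => huniq f hf, fun hf => by rw [hf]; exact he⟩⟩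

lemma isPruned_iff : D.IsPruned ↔ ∀ k, ¬ ∃! e, e.1 = k ∧ D.rotate e ≠ e := by
  constructor
  · intro h k
    rw [← D.isBlackBubble_iff]
    exact h.2 _
  · intro h
    refine ⟨D.isHurwitzGalaxy, fun F => ?_⟩
    obtain ⟨e, rfl⟩ := Quot.exists_rep F
    obtain ⟨k, j⟩ := e
    have h1 := h k
    rw [← D.isBlackBubble_iff, ← D.edgeBlackFace_eq_zero k j] at h1
    exact h1

/-! ### Descents after a block -/

/-- Since ℓ ≤ d, the inequality b = ℓ + d - 2 ≥ 1 excludes d = 1. -/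
lemma two_le (D : SingleHurwitzDyckPath μ) : 2 ≤ d := by
  have h1 := D.branchNumber_add_two
  have h2 := D.branchNumber_pos
  have h3 := μ.length_le
  omega

lemma height_of_descent {k : Fin d} {r : ℕ}
    (hr : ∀ n < r, IsDown D.path (D.dist k + branchNumber μ + n))
    {n : ℕ} (hn : n ≤ r) :
    height D.path (D.dist k + branchNumber μ + n) + n =
      height D.path (D.dist k) + branchNumber μ := by
  induction n with
  | zero => exact D.height_dist_add k le_rfl
  | succ n ih =>
    have h1 := (hr n (by omega)).height_eq
    have h2 := ih (by omega)
    rw [add_assoc _ n 1] at h1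
    omega

/-- A descent right after a block undoes its up-steps in reverse order, so the down-step with index
n matches the up-step with index b - 1 - n. -/
lemma whiteStart_of_descent {k : Fin d} {r : ℕ}
    (hr : ∀ n < r, IsDown D.path (D.dist k + branchNumber μ + n))
    {e : Fin d × Fin (branchNumber μ + 1)} (he : e.1 = k) {n : ℕ}
    (hen : (e.2 : ℕ) + n + 1 = branchNumber μ) (hn : n < r) :
    D.whiteStart e = D.dist k + branchNumber μ + n := by
  subst he
  rw [D.whiteStart_of_lt (by omega)]
  have h1 := D.height_dist_add e.1 (j := e.2 + 1) (by omega)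
  rw [← add_assoc] at h1
  have h2 := D.height_of_descent hr hn.le
  refine matchingDown_eq (by omega) (hr n hn) (by omega) fun z hz hz' => ?_
  rcases Nat.le_total z (D.dist e.1 + branchNumber μ) with h | h
  · obtain ⟨m, rfl⟩ : ∃ m, z = D.dist e.1 + m := ⟨z - D.dist e.1, by omega⟩
    rw [h1, D.height_dist_add e.1 (by omega)]
    omega
  · obtain ⟨m, rfl⟩ : ∃ m, z = D.dist e.1 + branchNumber μ + m := Nat.exists_eq_add_of_le h
    have := D.height_of_descent hr (n := m) (by omega)
    omega

lemma whiteEnd_blackNext_of_descent {k : Fin d} {r : ℕ}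
    (hr : ∀ n < r, IsDown D.path (D.dist k + branchNumber μ + n))
    {e : Fin d × Fin (branchNumber μ + 1)} (he : e.1 = k) {n : ℕ}
    (hen : (e.2 : ℕ) + n + 1 = branchNumber μ) (hn : n ≤ r) :
    D.whiteEnd (blackNext e) = D.dist k + branchNumber μ + n := by
  have h1 := blackNext_val_of_lt (e := e) (by omega)
  have h2 : (blackNext e).1 = k := he
  rcases n with _ | n
  · rw [D.whiteEnd_of_eq (by omega), h2, add_zero]
  · rw [D.whiteEnd_of_lt (by omega), D.whiteStart_of_descent hr h2 (n := n) (by omega) (by omega),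
      add_assoc]

lemma rotate_eq_self_iff_of_descent {k : Fin d} {r : ℕ}
    (hr : ∀ n < r, IsDown D.path (D.dist k + branchNumber μ + n))
    {e : Fin d × Fin (branchNumber μ + 1)} (he : e.1 = k) {n : ℕ}
    (hen : (e.2 : ℕ) + n + 1 = branchNumber μ) (hn : n < r) :
    D.rotate e = e ↔ ∀ i, ¬ D.Marks i (D.dist k + branchNumber μ + n) := by
  rw [D.rotate_eq_self_iff_of_lt (by omega), D.whiteEnd_blackNext_of_descent hr he hen hn.le,
    D.whiteStart_of_descent hr he hen hn]
  exact and_iff_right rfl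

/-- Away from the origin the internal edge always moves, so it is the only candidate for a unique
moved edge. -/
lemma existsUnique_rotate_ne_iff {k : Fin d} (hk : D.dist k ≠ 0) :
    (∃! e, e.1 = k ∧ D.rotate e ≠ e) ↔
      ∀ e, e.1 = k → (e.2 : ℕ) < branchNumber μ → D.rotate e = e := by
  have hlast : D.rotate (k, Fin.last _) ≠ (k, Fin.last _) := fun h =>
    hk ((D.rotate_eq_self_iff_of_eq (e := (k, Fin.last _)) rfl).1 h)
  constructor
  · rintro ⟨f, -, hf⟩ e he hlt
    by_contra hne
    have h1 : e = (k, Fin.last _) := (hf e ⟨he, hne⟩).trans (hf (k, Fin.last _) ⟨rfl, hlast⟩).symm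
    rw [h1] at hlt
    exact lt_irrefl _ hlt
  · intro h
    refine ⟨(k, Fin.last _), ⟨rfl, hlast⟩, fun e he => ?_⟩
    rcases snd_lt_or_eq e with hlt | heq
    · exact absurd (h e he.1 hlt) he.2
    · exact Prod.ext he.1 (Fin.ext heq)

/-- The descent condition says that the black polygons that do not start at the origin are not
bubbles. -/
lemma descentCondition_iff :
    D.DescentCondition ↔ ∀ k, D.dist k ≠ 0 → ¬ ∃! e, e.1 = k ∧ D.rotate e ≠ e := by
  have hb := D.branchNumber_pos
  constructor
  · intro hD k hk hun
    rw [D.existsUnique_rotate_ne_iff hk] at hun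
    -- An unmoved edge has its matching down-step right where the white side of the next black edge
    -- ends. Starting from the end of the block, this forces b consecutive down-steps.
    have hS : ∀ n, ∀ e : Fin d × Fin (branchNumber μ + 1), e.1 = k →
        (e.2 : ℕ) + n + 1 = branchNumber μ → D.whiteStart e = D.dist k + branchNumber μ + n := by
      intro n
      induction n with
      | zero =>
        intro e he hen
        have h1 := blackNext_val_of_lt (e := e) (by omega)
        rw [← ((D.rotate_eq_self_iff_of_lt (by omega)).1 (hun e he (by omega))).1,
          D.whiteEnd_of_eq (by omega), show (blackNext e).1 = k from he, add_zero]
      | succ n ih =>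
        intro e he hen
        have h1 := blackNext_val_of_lt (e := e) (by omega)
        rw [← ((D.rotate_eq_self_iff_of_lt (by omega)).1 (hun e he (by omega))).1,
          D.whiteEnd_of_lt (by omega), ih (blackNext e) he (by omega), add_assoc]
    have hedge : ∀ n < branchNumber μ, ∃ e : Fin d × Fin (branchNumber μ + 1), e.1 = k ∧
        (e.2 : ℕ) + n + 1 = branchNumber μ := fun n hn =>
      ⟨(k, ⟨branchNumber μ - 1 - n, by omega⟩), rfl, by
        change branchNumber μ - 1 - n + n + 1 = _
        omega⟩
    have hdown : ∀ n < branchNumber μ, IsDown D.path (D.dist k + branchNumber μ + n) := by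
      intro n hn
      obtain ⟨e, he, hen⟩ := hedge n hn
      rw [← hS n e he hen]
      exact D.isDown_whiteStart (by omega)
    have hx : D.dist k + (branchNumber μ - 1) + 1 = D.dist k + branchNumber μ := by omega
    obtain ⟨i, p, hp, h1, h2⟩ := hD (D.dist k + (branchNumber μ - 1))
      (D.isUp_dist_add k (by omega)) (fun j hj => by rw [hx]; exact hdown j hj)
    rw [hx] at h1 h2
    obtain ⟨n, rfl⟩ := Nat.exists_eq_add_of_le h1
    rcases Nat.lt_or_ge n (branchNumber μ) with hn | hn
    · obtain ⟨e, he, hen⟩ := hedge n hn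
      exact (D.rotate_eq_self_iff_of_descent hdown he hen hn).1 (hun e he (by omega)) i hp
    -- The last point of the descent has the height of `dist k`, so its residue forbids a mark; it
    -- is the one point of the descent that starts none of its down-steps.
    · have hn' : n = branchNumber μ := by omega
      have h3 := D.height_of_descent hdown hn'.le
      refine D.residue_left_ne_dist (i := i) hk ?_
      rw [← D.height_of_marks hp]
      congr 1
      omega
  · intro h x hx hdown
    by_contra hno
    have hno' : ∀ i p, D.Marks i p → x + 1 ≤ p → ¬ p ≤ x + 1 + branchNumber μ :=
      fun i p h1 h2 h3 => hno ⟨i, p, h1, h2, h3⟩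
    obtain ⟨e, he⟩ := D.exists_whiteEnd_eq (p := x + 1)
      (D.isNode_of_not_isUp hx.lt_length (hdown 0 hb).not_isUp) (by omega)
    have hlast : (e.2 : ℕ) = branchNumber μ := by
      refine (snd_lt_or_eq e).resolve_left fun hlt => ?_
      rw [D.whiteEnd_of_lt hlt] at he
      have h1 := (D.isDown_whiteStart hlt).not_isUp
      rw [show D.whiteStart e = x by omega] at h1
      exact h1 hx
    rw [D.whiteEnd_of_eq hlast] at he
    rw [← he] at hdown hno'
    -- A block at the origin followed by b down-steps would end on the axis, giving a path of length
    -- 2b, whereas the length is 2bd with d ≥ 2.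
    have hk : D.dist e.1 ≠ 0 := by
      intro h0
      have h1 := D.height_of_descent hdown le_rfl
      have h2 := (hdown (branchNumber μ - 1) (by omega)).lt_length
      have h3 : D.path.toList.length = 2 * branchNumber μ := by
        by_contra hne
        have := D.height_pos (x := D.dist e.1 + branchNumber μ + branchNumber μ) (by omega)
          (by omega)
        rw [h0, height_zero] at h1
        rw [h0] at this
        omega
      have h4 := D.two_le
      have h5 := Nat.mul_le_mul_left (2 * branchNumber μ) h4
      rw [← D.length_eq, h3] at h5
      omega
    refine h e.1 hk ((D.existsUnique_rotate_ne_iff hk).2 fun f hf hlt => ?_)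
    obtain ⟨n, hn⟩ : ∃ n, (f.2 : ℕ) + n + 1 = branchNumber μ :=
      ⟨branchNumber μ - 1 - f.2, by omega⟩
    rw [D.rotate_eq_self_iff_of_descent hdown hf hn (by omega)]
    exact fun i hi => hno' i _ hi (by omega) (by omega)

/-! ### The black polygon at the origin -/

lemma IsSecondDistinguished.pos {v : ℕ} {D : SingleHurwitzDyckPath μ}
    (h : D.IsSecondDistinguished v) : 0 < v := by
  have : (0 : ℕ) ∈ {u | IsDistinguished (branchNumber μ) D.path u ∧ u < v} := by rw [h.2]; rfl
  exact this.2

lemma IsSecondDistinguished.le {v u : ℕ} {D : SingleHurwitzDyckPath μ}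
    (h : D.IsSecondDistinguished v) (hu : IsDistinguished (branchNumber μ) D.path u)
    (h0 : u ≠ 0) : v ≤ u := by
  by_contra hlt
  have : u ∈ {u | IsDistinguished (branchNumber μ) D.path u ∧ u < v} := ⟨hu, by omega⟩
  rw [h.2] at this
  exact h0 this

lemma exists_dist_ne_zero : ∃ k, D.dist k ≠ 0 := by
  have h := D.two_le
  by_contra! hk
  have := D.dist_injective ((hk ⟨0, by omega⟩).trans (hk ⟨1, by omega⟩).symm)
  rw [Fin.mk.injEq] at this
  omega

lemma exists_isSecondDistinguished : ∃ v, D.IsSecondDistinguished v := by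
  classical
  have hex : ∃ v, IsDistinguished (branchNumber μ) D.path v ∧ v ≠ 0 := by
    obtain ⟨k, hk⟩ := D.exists_dist_ne_zero
    exact ⟨D.dist k, D.isDistinguished_dist k, hk⟩
  obtain ⟨h1, h2⟩ := Nat.find_spec hex
  refine ⟨Nat.find hex, h1, Set.ext fun u => ⟨fun hu => ?_, ?_⟩⟩
  · by_contra h0
    exact Nat.find_min hex hu.2 ⟨hu.1, h0⟩
  · rintro rfl
    exact ⟨D.isDistinguished_zero, Nat.pos_of_ne_zero h2⟩

lemma height_ne_zero_of_isDistinguished {v : ℕ} (hv : IsDistinguished (branchNumber μ) D.path v)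
    (h0 : v ≠ 0) : height D.path v ≠ 0 := by
  obtain ⟨k, rfl⟩ := D.exists_dist_eq hv
  exact fun h => h0 (D.dist_eq_zero_iff.2 h)

lemma eq_of_height_eq {u v : ℕ} (hu : IsDistinguished (branchNumber μ) D.path u)
    (hv : IsDistinguished (branchNumber μ) D.path v) (h : height D.path u = height D.path v) :
    u = v := by
  obtain ⟨k, rfl⟩ := D.exists_dist_eq hu
  obtain ⟨l, rfl⟩ := D.exists_dist_eq hv
  rw [D.eq_of_height_dist_eq h]

lemma exists_isLowestDistinguished : ∃ v, D.IsLowestDistinguished v := by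
  classical
  obtain ⟨k, hk, hmin⟩ := Finset.exists_min_image (Finset.univ.filter fun k => D.dist k ≠ 0)
    (fun k => height D.path (D.dist k)) (by
      obtain ⟨k, hk⟩ := D.exists_dist_ne_zero
      exact ⟨k, Finset.mem_filter.2 ⟨Finset.mem_univ _, hk⟩⟩)
  refine ⟨D.dist k, ⟨D.isDistinguished_dist k, D.height_ne_zero_of_isDistinguished
    (D.isDistinguished_dist k) (Finset.mem_filter.1 hk).2⟩, fun u hu hu0 => ?_⟩
  obtain ⟨l, rfl⟩ := D.exists_dist_eq hu
  exact hmin l (Finset.mem_filter.2 ⟨Finset.mem_univ _, fun h => hu0 (by rw [h, height_zero])⟩)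

lemma IsLowestDistinguished.eq {u v : ℕ} {D : SingleHurwitzDyckPath μ}
    (hu : D.IsLowestDistinguished u) (hv : D.IsLowestDistinguished v) : u = v :=
  D.eq_of_height_eq hu.1.1 hv.1.1 (le_antisymm (hu.2 v hv.1.1 hv.1.2) (hv.2 u hu.1.1 hu.1.2))

lemma not_lowestDistinguishedVertexCondition_iff {v : ℕ} (hv : D.IsLowestDistinguished v) :
    ¬ D.LowestDistinguishedVertexCondition ↔
      D.IsSecondDistinguished v ∧ ∀ i p, i ≠ D.root → D.Marks i p → v ≤ p := by
  constructor
  · intro h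
    refine ⟨by_contra fun h' => h ⟨v, hv, Or.inl h'⟩, fun i p hi hp => ?_⟩
    exact not_lt.1 fun hlt => h ⟨v, hv, Or.inr ⟨i, p, hi, hp, hlt⟩⟩
  · rintro ⟨h1, h2⟩ ⟨u, hu, h⟩
    rw [hu.eq hv] at h
    rcases h with h | ⟨i, p, hi, hp, hlt⟩
    · exact h h1
    · exact absurd (h2 i p hi hp) (by omega)

lemma branchNumber_le_of_isNode {p : ℕ} (hp : D.IsNode p) (h0 : p ≠ 0) : branchNumber μ ≤ p := by
  obtain ⟨k, hk⟩ := D.exists_dist_eq_zero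
  have h1 := D.whiteEnd_le_of_lt (e := (k, Fin.last _)) hp (by
    rw [D.whiteStart_of_eq rfl, hk]; omega)
  rw [D.whiteEnd_of_eq rfl, hk] at h1
  omega

/-- After a down-step that starts at or below the lowest distinguished vertex, the path does not
rise. -/
lemma IsLowestDistinguished.height_le {v x y : ℕ} {D : SingleHurwitzDyckPath μ}
    (hv : D.IsLowestDistinguished v) (hx : IsDown D.path x)
    (hxv : height D.path x ≤ height D.path v) (hxy : x < y) (hy : y ≤ D.path.toList.length) :
    height D.path y < height D.path x := by
  by_contra hlt
  have h1 := hx.height_eq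
  obtain ⟨p, h2, h3, h4, h5⟩ := D.isBDyck.exists_isDistinguished_of_height_lt hx.not_isUp hxy hy
    (by omega)
  have := hv.2 p h4 (D.height_ne_zero_of_isDistinguished h4 (by omega))
  omega

/-- For the polygon at the origin, the up-step with index j ends at height j + 1. -/
lemma exists_edge_of_height (k₀ : Fin d) {h : ℕ} (h0 : h ≠ 0) (hb : h ≤ branchNumber μ) :
    ∃ e : Fin d × Fin (branchNumber μ + 1), e.1 = k₀ ∧ (e.2 : ℕ) + 1 = h :=
  ⟨(k₀, ⟨h - 1, by omega⟩), rfl, by change h - 1 + 1 = h; omega⟩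

lemma isDown_of_lt_second {k₀ : Fin d} (hk₀ : D.dist k₀ = 0)
    {v : ℕ} (hv : D.IsSecondDistinguished v) {n : ℕ}
    (hn : n < v - branchNumber μ) : IsDown D.path (D.dist k₀ + branchNumber μ + n) := by
  have hL := hv.1.2.lt_length
  refine isDown_of_not_isUp (by omega) fun hu => ?_
  obtain ⟨x, j, hx, hj, h⟩ := D.isBDyck.exists_block hu
  have h0 : x ≠ 0 := by omega
  have := hv.le hx h0
  omega

lemma height_second {k₀ : Fin d} (hk₀ : D.dist k₀ = 0)
    {v : ℕ} (hv : D.IsSecondDistinguished v) :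
    v = D.dist k₀ + branchNumber μ + (v - branchNumber μ) ∧
      height D.path v + (v - branchNumber μ) = branchNumber μ := by
  have h1 := D.branchNumber_le_of_isNode (p := v) ⟨hv.1.2.lt_length.le, hv.1.1⟩ hv.pos.ne'
  have h2 := D.height_of_descent (fun n hn => D.isDown_of_lt_second hk₀ hv hn) le_rfl
  have h3 : v = D.dist k₀ + branchNumber μ + (v - branchNumber μ) := by omega
  rw [← h3, hk₀, height_zero, zero_add] at h2
  exact ⟨h3, h2⟩

/-- The descent from the first block stops at the second distinguished vertex, which is therefore
met before the match of the up-step ending at its height. -/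
lemma rotate_ne_of_second {k₀ : Fin d} (hk₀ : D.dist k₀ = 0)
    {v : ℕ} (hv : D.IsSecondDistinguished v)
    {e : Fin d × Fin (branchNumber μ + 1)} (he : e.1 = k₀) (hev : (e.2 : ℕ) + 1 = height D.path v) :
    D.rotate e ≠ e := by
  obtain ⟨h1, h2⟩ := D.height_second hk₀ hv
  have hlt : (e.2 : ℕ) < branchNumber μ := by omega
  intro hrot
  rw [D.rotate_eq_self_iff_of_lt hlt, D.whiteEnd_blackNext_eq_iff hlt,
    D.whiteEnd_blackNext_of_descent (fun n hn => D.isDown_of_lt_second hk₀ hv hn) he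
      (n := v - branchNumber μ) (by omega) le_rfl, ← h1] at hrot
  exact hrot.1 hv.1

/-- If the edge were fixed, the path would stay strictly above this height between the up-step and
its match and strictly below it afterwards, leaving no place for `v`. -/
lemma rotate_ne_of_lowest {k₀ : Fin d} (hk₀ : D.dist k₀ = 0)
    {v v' : ℕ} (hv : D.IsLowestDistinguished v)
    (hv' : D.IsSecondDistinguished v') (hne : v ≠ v') {e : Fin d × Fin (branchNumber μ + 1)}
    (he : e.1 = k₀) (hev : (e.2 : ℕ) + 1 = height D.path v) : D.rotate e ≠ e := by
  have hv0 : v ≠ 0 := fun h => hv.1.2 (by rw [h, height_zero])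
  have h1 := hv.2 v' hv'.1 (D.height_ne_zero_of_isDistinguished hv'.1 hv'.pos.ne')
  have h2 := D.height_second hk₀ hv'
  have h3 := hv'.le hv.1.1 hv0
  have hlt : (e.2 : ℕ) < branchNumber μ := by omega
  intro hrot
  have hA := ((D.rotate_eq_self_iff_of_lt hlt).1 hrot).1
  obtain ⟨h4, h5, h6⟩ := D.whiteEnd_blackNext_of_lt hlt
  have hS := D.height_whiteStart_of_lt hlt
  rw [he, hk₀, height_zero] at hS
  rw [he, hk₀] at h4 h6
  have h7 := hv.height_le (D.isDown_whiteStart hlt) (by omega) (y := v)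
  have h8 := hv.1.1.2.lt_length
  by_cases h9 : v = D.whiteStart e
  · exact (D.isDown_whiteStart hlt).not_isUp (h9 ▸ hv.1.1.2)
  · have := h6 v (by omega)
    omega

/-- The black polygon at the origin is a bubble if and only if the lowest distinguished vertex
condition fails. -/
lemma existsUnique_rotate_ne_iff_of_dist_eq_zero {k₀ : Fin d} (hk₀ : D.dist k₀ = 0) :
    (∃! e, e.1 = k₀ ∧ D.rotate e ≠ e) ↔ ¬ D.LowestDistinguishedVertexCondition := by
  have hb := D.branchNumber_pos
  obtain ⟨v, hv⟩ := D.exists_isLowestDistinguished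
  obtain ⟨v', hv'⟩ := D.exists_isSecondDistinguished
  rw [D.not_lowestDistinguishedVertexCondition_iff hv]
  obtain ⟨hv'1, hv'2⟩ := D.height_second hk₀ hv'
  have hv'0 := D.height_ne_zero_of_isDistinguished hv'.1 hv'.pos.ne'
  have hle := hv.2 v' hv'.1 hv'0
  have hdown : ∀ n < v' - branchNumber μ, IsDown D.path (D.dist k₀ + branchNumber μ + n) :=
    fun n hn => D.isDown_of_lt_second hk₀ hv' hn
  obtain ⟨f, hf, hfv⟩ := exists_edge_of_height (μ := μ) k₀ hv'0 (by omega)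
  have hfrot := D.rotate_ne_of_second hk₀ hv' hf hfv
  constructor
  · rintro ⟨g, -, hg⟩
    have huniq : ∀ e, e.1 = k₀ → D.rotate e ≠ e → e = f := fun e h1 h2 =>
      (hg e ⟨h1, h2⟩).trans (hg f ⟨hf, hfrot⟩).symm
    -- The lowest and the second distinguished vertex each move an edge; uniqueness makes the edges,
    -- hence the heights, equal.
    obtain rfl : v = v' := by
      by_contra hne
      obtain ⟨e, he, hev⟩ := exists_edge_of_height (μ := μ) k₀ hv.1.2 (by omega)
      have := huniq e he (D.rotate_ne_of_lowest hk₀ hv hv' hne he hev)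
      rw [this] at hev
      exact hne (D.eq_of_height_eq hv.1.1 hv'.1 (by omega))
    refine ⟨hv', fun i p hi hp => ?_⟩
    by_contra hlt
    have hpos := D.height_left_pos hi
    rw [← D.height_of_marks hp] at hpos
    have hp0 : p ≠ 0 := by rintro rfl; rw [height_zero] at hpos; omega
    have hnode : D.IsNode p := by
      rcases hp with rfl | rfl
      · exact D.isNode_left i
      · exact D.isNode_right i
    have hbp := D.branchNumber_le_of_isNode hnode hp0
    -- A marked point before `v` lies on the first descent, at height b - n above that of `v`, and
    -- so moves another edge.
    obtain ⟨n, rfl⟩ : ∃ n, p = D.dist k₀ + branchNumber μ + n := ⟨p - branchNumber μ, by omega⟩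
    obtain ⟨e, he, hen⟩ := exists_edge_of_height (μ := μ) k₀ (h := branchNumber μ - n) (by omega)
      (by omega)
    have := huniq e he fun h =>
      (D.rotate_eq_self_iff_of_descent hdown he (n := n) (by omega) (by omega)).1 h i hp
    rw [this] at hen
    omega
  · rintro ⟨hsec, hmarks⟩
    obtain rfl : v = v' := le_antisymm (hsec.le hv'.1 hv'.pos.ne') (hv'.le hsec.1 hsec.pos.ne')
    refine ⟨f, ⟨hf, hfrot⟩, ?_⟩
    rintro e ⟨he, hrot⟩
    by_contra hne
    apply hrot
    rcases snd_lt_or_eq e with hlt | heq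
    swap
    · rw [D.rotate_eq_self_iff_of_eq heq, he, hk₀]
    obtain ⟨n, hn⟩ : ∃ n, (e.2 : ℕ) + n + 1 = branchNumber μ :=
      ⟨branchNumber μ - 1 - e.2, by omega⟩
    -- The head of `e` has height b - n, and `v` has height b - (v - b): the cases are heads above,
    -- level with and below `v`.
    rcases lt_trichotomy n (v - branchNumber μ) with h | h | h
    · rw [D.rotate_eq_self_iff_of_descent hdown he hn h]
      intro i hi
      by_cases hroot : i = D.root
      · have h1 := D.left_root
        have h2 := D.right_root_eq
        have h3 := hsec.1.2.lt_length
        rw [hroot] at hi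
        rcases hi with hi | hi <;> omega
      · have := hmarks i _ hroot hi
        omega
    · exact absurd (Prod.ext (he.trans hf.symm) (Fin.ext (by omega))) hne
    · obtain ⟨h4, h5, h6⟩ := D.whiteEnd_blackNext_of_lt hlt
      have hS := D.height_whiteStart_of_lt hlt
      rw [he, hk₀, height_zero] at hS
      rw [he, hk₀] at h4 h6
      have hA : D.whiteEnd (blackNext e) = D.whiteStart e := by
        rw [D.whiteEnd_blackNext_eq_iff hlt]
        intro hd
        have := hv.2 _ hd (by omega)
        omega
      rw [D.rotate_eq_self_iff_of_lt hlt]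
      refine ⟨hA, fun i hi => ?_⟩
      -- A partner would be another node of the same height, but the path is strictly higher before
      -- the match, back to the end of the up-step, and strictly lower after it.
      have h7 := D.partner_ne_of_marks hi
      have h8 := D.height_partner (D.whiteStart e)
      have h9 := D.isNode_partner (D.isNode_whiteStart e)
      have h10 : D.partner (D.whiteStart e) ≠ 0 := by
        intro h0
        rw [h0, height_zero] at h8
        omega
      have h11 := D.branchNumber_le_of_isNode h9 h10
      rcases lt_or_gt_of_ne h7 with h12 | h12
      · have := h6 (D.partner (D.whiteStart e)) (by omega) (by omega)
        omega
      · have := hv.height_le (D.isDown_whiteStart hlt) (by omega) h12 h9.1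
        omega

theorem isPruned_iff_conditions :
    D.IsPruned ↔ D.DescentCondition ∧ D.LowestDistinguishedVertexCondition := by
  obtain ⟨k₀, hk₀⟩ := D.exists_dist_eq_zero
  have h₀ := D.existsUnique_rotate_ne_iff_of_dist_eq_zero hk₀
  rw [D.isPruned_iff, D.descentCondition_iff]
  constructor
  · intro h
    exact ⟨fun k _ => h k, not_not.1 fun hn => h k₀ (h₀.2 hn)⟩
  · rintro ⟨h1, h2⟩ k
    by_cases hk : D.dist k = 0
    · rw [D.dist_injective (hk.trans hk₀.symm)]
      exact fun h => h₀.1 h h2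
    · exact h1 k hk

end SingleHurwitzDyckPath

end Hurwitz

theorem mainTheorem2 {d : ℕ} (μ : Composition d) (D : Hurwitz.SingleHurwitzDyckPath μ) :
    Hurwitz.IsHurwitzGalaxy 0 μ (Composition.ones d) D.galaxy ∧
      (D.IsPruned ↔ D.DescentCondition ∧ D.LowestDistinguishedVertexCondition) := by
  exact ⟨D.isHurwitzGalaxy, D.isPruned_iff_conditions⟩
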